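/- **Setting.** Let $H$ be a separable real Hilbert space with scalar product $\langle\cdot,\cdot\rangle$ and norm $|\cdot|$, and let $\mathcal A$ be a (possibly unbounded) self-adjoint positive definite operator on $H$. Put $V=\mathrm{dom}(\mathcal A^{1/2})$ with norm $\|x\|=|\mathcal A^{1/2}x|$ and assume that $V$ embeds continuously in $H$; let $V'$ be the dual of $V$, with duality $\langle\cdot,\cdot\rangle$ and $H\cong H'\subset V'$, and regard $\mathcal A$ as the bounded operator $V\to V'$, $\langle\mathcal A u,v\rangle=\langle\mathcal A^{1/2}u,\mathcal A^{1/2}v\rangle$. Let $T\in(0,\infty)$, let $Z$ be a locally compact Polish space, $\nu$ a Borel measure on $Z$ that is finite on compact sets, $\nu_T=\mathrm{Leb}_{[0,T]}\otimes\nu$ on $[0,T]\times Z$, and for $m>0$ let $B_2(m)$ be the closed ball of radius $m$ about $0$ in $L^2(\nu_T)$ (real-valued functions). Let $B:V\times V\to V'$ be a continuous bilinear map such that * $\langle B(u_1,u_2),u_3\rangle=-\langle B(u_1,u_3),u_2\rangle$ for all $u_1,u_2,u_3\in V$; * for some reflexive separable Banach space $(Q,|\cdot|_Q)$ with $V\subset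 Q\subset H$ and some $a_0>0$: $|v|_Q^2\le a_0|v|\,\|v\|$ for all $v\in V$; * for some $C>0$: $|\langle B(u,v),w\rangle|\le C|u|_Q\|v\||w|_Q$ for all $u,v,w\in V$. Let $G:[0,T]\times H\times Z\to H$ be measurable, and suppose that there are $\rho>0$ and $L_1,L_2,L_3:[0,T]\times Z\to[0,\infty)$ in $L^2(\nu_T)$ with $\int_U e^{\rho L_i}\,d\nu_T<\infty$ for every measurable $U$ with $\nu_T(U)<\infty$, such that for all $t\in[0,T]$, $z\in Z$ and $v,v_1,v_2\in V$ $$|G(t,v_1,z)-G(t,v_2,z)|\le L_1(t,z)|v_1-v_2|,\qquad |G(t,v,z)|\le L_2(t,z)+L_3(t,z)|v|.$$ Let $u_0\in H$, and let $u^0\in C([0,T];H)\cap L^2([0,T];V)$ be the solution of $du^0+\mathcal A u^0\,dt+B(u^0,u^0)\,dt=0$, $u^0(0)=u_0$. For $\varphi\in L^2(\nu_T)$ let $Y^\varphi\in C([0,T];H)\cap L^2([0,T];V)$ denote the solution of the skeleton equation $$\frac{dY^\varphi(t)}{dt}+\mathcal A Y^\varphi(t)+B(Y^\varphi(t),u^0(t))+B(u^0(t),Y^\varphi(t))=\int_Z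 G(t,u^0(t),z)\varphi(t,z)\,\nu(dz),\qquad Y^\varphi(0)=0.$$ Both equations are understood in integrated form in $V'$: for every $t\in[0,T]$, tested with every $v\in V$. **Proposition.** Let $m\in(0,\infty)$, let $\varphi_n\in B_2(m)$ for $n\in\mathbb N$ and $\varphi\in B_2(m)$, and let $\varphi_n\to\varphi$ weakly in $L^2(\nu_T)$. Then $$\lim_{n\to\infty}Y^{\varphi_n}=Y^\varphi\quad\text{in } D([0,T];H)\cap L^2([0,T];V),$$ that is, $Y^{\varphi_n}\to Y^\varphi$ both in the Skorokhod ($J_1$) topology of the space $D([0,T];H)$ of càdlàg paths and in the norm of $L^2([0,T];V)$. -/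

import Mathlib

open MeasureTheory Filter Topology Set
open scoped ENNReal

noncomputable section

namespace Hydro

/-! ### The operator `𝒜`, its square root, and the space `V` -/

/-- `S` is the square root `A^{1/2}` of the unbounded operator `A`: a nonnegative self-adjoint
operator with `S ∘ S = A`, equality of the (natural) domains included. A nonnegative self-adjoint
operator has exactly one such root. -/
structure IsSqrt {H : Type*} [NormedAddCommGroup H] [InnerProductSpace ℝ H] [CompleteSpace H]
    (S A : H →ₗ.[ℝ] H) : Prop where
  selfAdjoint : IsSelfAdjoint S
  nonneg : ∀ x : S.domain, 0 ≤ inner ℝ (S x) (x : H)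
  mem_domain_iff : ∀ x : H,
    x ∈ A.domain ↔ ∃ h : x ∈ S.domain, S ⟨x, h⟩ ∈ S.domain
  sq_apply : ∀ (x : A.domain) (h : (x : H) ∈ S.domain) (h' : S ⟨x, h⟩ ∈ S.domain),
    S ⟨S ⟨x, h⟩, h'⟩ = A x

/-- A (possibly unbounded) self-adjoint positive definite operator `A` on the Hilbert space `H`,
with its square root, such that `dom(A^{1/2})` with the norm `|A^{1/2} x|` embeds continuously
in `H`. -/
structure PosDefOperator (H : Type*) [NormedAddCommGroup H] [InnerProductSpace ℝ H]
    [CompleteSpace H] where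
  A : H →ₗ.[ℝ] H
  selfAdjoint : IsSelfAdjoint A
  posDef : ∀ x : A.domain, (x : H) ≠ 0 → 0 < inner ℝ (A x) (x : H)
  sqrtA : H →ₗ.[ℝ] H
  isSqrt : IsSqrt sqrtA A
  continuous_embedding : ∃ c : ℝ, ∀ x : sqrtA.domain, ‖(x : H)‖ ≤ c * ‖sqrtA x‖

namespace PosDefOperator

variable {H : Type*} [NormedAddCommGroup H] [InnerProductSpace ℝ H] [CompleteSpace H]

/-- The space `V = dom(A^{1/2})`, a type of its own because it does not carry the norm of `H`. -/
def V (P : PosDefOperator H) : Type _ := P.sqrtA.domain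

instance (P : PosDefOperator H) : AddCommGroup P.V :=
  inferInstanceAs (AddCommGroup P.sqrtA.domain)

instance (P : PosDefOperator H) : Module ℝ P.V :=
  inferInstanceAs (Module ℝ P.sqrtA.domain)

/-- The inclusion `V ⊆ H`. -/
def incl (P : PosDefOperator H) : P.V →ₗ[ℝ] H := P.sqrtA.domain.subtype

/-- `A^{1/2}` as an everywhere defined linear map on `V`. -/
def sqrtV (P : PosDefOperator H) : P.V →ₗ[ℝ] H := P.sqrtA.toFun

theorem sqrtV_injective (P : PosDefOperator H) (x : P.V) (hx : P.sqrtV x = 0) : x = 0 := by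
  obtain ⟨c, hc⟩ := P.continuous_embedding
  have h := hc x
  have h0 : P.sqrtA x = 0 := hx
  rw [h0, norm_zero, mul_zero] at h
  exact Subtype.ext (norm_le_zero_iff.mp h)

/-- The scalar product `(x, y)_V = ⟨A^{1/2} x, A^{1/2} y⟩`. -/
@[reducible]
def core (P : PosDefOperator H) : InnerProductSpace.Core ℝ P.V where
  inner x y := inner ℝ (P.sqrtV x) (P.sqrtV y)
  conj_inner_symm x y := inner_conj_symm _ _
  re_inner_nonneg x := real_inner_self_nonneg
  add_left x y z := by simp only [map_add, inner_add_left]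
  smul_left x y r := by simp only [map_smul, inner_smul_left]
  definite x hx := P.sqrtV_injective x (inner_self_eq_zero.mp hx)

instance (P : PosDefOperator H) : NormedAddCommGroup P.V :=
  @InnerProductSpace.Core.toNormedAddCommGroup ℝ P.V _ _ _ P.core

instance (P : PosDefOperator H) : InnerProductSpace ℝ P.V :=
  InnerProductSpace.ofCore P.core.toCore

theorem inner_V (P : PosDefOperator H) (x y : P.V) :
    inner ℝ x y = inner ℝ (P.sqrtV x) (P.sqrtV y) := rfl

theorem norm_V (P : PosDefOperator H) (x : P.V) : ‖x‖ = ‖P.sqrtV x‖ := by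
  rw [norm_eq_sqrt_real_inner, norm_eq_sqrt_real_inner, inner_V]

/-- `𝒜` as a bounded operator from `V` to `V'`: `⟨𝒜 u, v⟩ = ⟨A^{1/2} u, A^{1/2} v⟩`. -/
def opA (P : PosDefOperator H) : P.V →L[ℝ] P.V →L[ℝ] ℝ := innerSL ℝ

open Classical in
/-- An element of `H`, seen as an element of `V` if it lies there (and `0` otherwise). -/
def toV (P : PosDefOperator H) (x : H) : P.V :=
  if h : x ∈ P.sqrtA.domain then ⟨x, h⟩ else 0

/-- `Y ∈ C([0,T];H) ∩ L²([0,T];V)`. Only the values of `Y` on `[0,T]` matter. -/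
structure MemCL2 (P : PosDefOperator H) (T : ℝ) (Y : ℝ → H) : Prop where
  continuousOn : ContinuousOn Y (Icc 0 T)
  mem_V : ∀ᵐ t ∂volume.restrict (Icc 0 T), Y t ∈ P.sqrtA.domain
  memLp : MemLp (fun t => P.toV (Y t)) 2 (volume.restrict (Icc 0 T))

end PosDefOperator

/-! ### Topology of `D([0,T];H) ∩ L²([0,T];V)` -/

/-- The Skorokhod (J1) distance of two paths `[0,T] → E`: the infimum, over all increasing
bijections `θ` of `[0,T]`, of `max (sup_t |θ t - t|) (sup_t d(x (θ t), y t))`. -/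
def skorokhodEDist {E : Type*} [PseudoEMetricSpace E] (T : ℝ) (x y : ℝ → E) : ℝ≥0∞ :=
  ⨅ θ : Icc (0 : ℝ) T ≃o Icc (0 : ℝ) T,
    max (⨆ t : Icc (0 : ℝ) T, edist (θ t) t) (⨆ t : Icc (0 : ℝ) T, edist (x (θ t)) (y t))

/-- Convergence `Yₙ → Y` in `D([0,T];H) ∩ L²([0,T];V)`: in the Skorokhod topology of
`D([0,T];H)` and in the norm of `L²([0,T];V)`. -/
def TendstoDL2 {H : Type*} [NormedAddCommGroup H] [InnerProductSpace ℝ H] [CompleteSpace H]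
    (P : PosDefOperator H) (T : ℝ) (Yn : ℕ → ℝ → H) (Y : ℝ → H) : Prop :=
  Tendsto (fun n => skorokhodEDist T (Yn n) Y) atTop (𝓝 0) ∧
  Tendsto (fun n => eLpNorm (fun t => P.toV (Yn n t) - P.toV (Y t)) 2
    (volume.restrict (Icc 0 T))) atTop (𝓝 0)

/-! ### The coefficients -/

/-- The assumptions on the continuous bilinear map `B : V × V → V'`; the Banach space `Q` with
`V ⊆ Q ⊆ H` is given with its two inclusion maps. -/
structure AssumptionB {H : Type*} [NormedAddCommGroup H] [InnerProductSpace ℝ H] [CompleteSpace H]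
    (P : PosDefOperator H) (Q : Type*) [NormedAddCommGroup Q] [NormedSpace ℝ Q]
    (VtoQ : P.V →ₗ[ℝ] Q) (QtoH : Q →ₗ[ℝ] H)
    (B : P.V →L[ℝ] P.V →L[ℝ] (P.V →L[ℝ] ℝ)) : Prop where
  skew : ∀ u₁ u₂ u₃ : P.V, B u₁ u₂ u₃ = -B u₁ u₃ u₂
  complete : CompleteSpace Q
  separable : TopologicalSpace.SeparableSpace Q
  reflexive : Function.Surjective (NormedSpace.inclusionInDoubleDual ℝ Q)
  QtoH_injective : Function.Injective QtoH
  QtoH_VtoQ : ∀ v : P.V, QtoH (VtoQ v) = P.incl v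
  interpolation : ∃ a₀ : ℝ, 0 < a₀ ∧ ∀ v : P.V, ‖VtoQ v‖ ^ 2 ≤ a₀ * ‖P.incl v‖ * ‖v‖
  bound : ∃ C : ℝ, 0 < C ∧ ∀ u v w : P.V, |B u v w| ≤ C * ‖VtoQ u‖ * ‖v‖ * ‖VtoQ w‖

/-- The measure `ν_T = Leb_T ⊗ ν`, carried by `[0,T] × Z`. -/
def nuT {Z : Type*} [MeasurableSpace Z] (T : ℝ) (ν : Measure Z) : Measure (ℝ × Z) :=
  (volume.restrict (Icc 0 T)).prod ν

/-- `h ∈ ℋ^ρ`: `h ≥ 0` on `[0,T] × Z`, and `e^{ρ h}` is integrable over every measurable set of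
finite `ν_T`-measure. -/
def MemExpClass {Z : Type*} [MeasurableSpace Z] (T : ℝ) (ν : Measure Z) (ρ : ℝ)
    (h : ℝ → Z → ℝ) : Prop :=
  (∀ t ∈ Icc 0 T, ∀ z, 0 ≤ h t z) ∧
  ∀ U : Set (ℝ × Z), MeasurableSet U → nuT T ν U < ∞ →
    ∫⁻ p in U, ENNReal.ofReal (Real.exp (ρ * h p.1 p.2)) ∂(nuT T ν) < ∞

/-- The assumptions on `G : [0,T] × H × Z → H`. -/
structure AssumptionG {H : Type*} [NormedAddCommGroup H] [InnerProductSpace ℝ H] [CompleteSpace H]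
    [MeasurableSpace H] {Z : Type*} [MeasurableSpace Z]
    (P : PosDefOperator H) (T : ℝ) (ν : Measure Z) (G : ℝ → H → Z → H) : Prop where
  measurable : Measurable fun p : Icc (0 : ℝ) T × H × Z => G p.1 p.2.1 p.2.2
  bounds : ∃ (ρ : ℝ) (L₁ L₂ L₃ : ℝ → Z → ℝ), 0 < ρ ∧
    (MemExpClass T ν ρ L₁ ∧ MemLp (fun p : ℝ × Z => L₁ p.1 p.2) 2 (nuT T ν)) ∧
    (MemExpClass T ν ρ L₂ ∧ MemLp (fun p : ℝ × Z => L₂ p.1 p.2) 2 (nuT T ν)) ∧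
    (MemExpClass T ν ρ L₃ ∧ MemLp (fun p : ℝ × Z => L₃ p.1 p.2) 2 (nuT T ν)) ∧
    (∀ t ∈ Icc 0 T, ∀ (v₁ v₂ : P.V) (z : Z),
      ‖G t (P.incl v₁) z - G t (P.incl v₂) z‖ ≤ L₁ t z * ‖P.incl v₁ - P.incl v₂‖) ∧
    (∀ t ∈ Icc 0 T, ∀ (v : P.V) (z : Z),
      ‖G t (P.incl v) z‖ ≤ L₂ t z + L₃ t z * ‖P.incl v‖)

/-! ### The two equations -/

section Equations

variable {H : Type*} [NormedAddCommGroup H] [InnerProductSpace ℝ H] [CompleteSpace H]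

/-- `u⁰ ∈ C([0,T];H) ∩ L²([0,T];V)` solves `du⁰ + 𝒜u⁰ dt + B(u⁰,u⁰) dt = 0`, `u⁰(0) = x₀`,
i.e. the integrated equation holds in `V'` for every `t ∈ [0,T]`. -/
structure IsLimitSolution (P : PosDefOperator H) (B : P.V →L[ℝ] P.V →L[ℝ] (P.V →L[ℝ] ℝ))
    (T : ℝ) (x₀ : H) (u₀ : ℝ → H) : Prop where
  mem : P.MemCL2 T u₀
  eqn : ∀ t ∈ Icc 0 T, ∀ v : P.V,
    inner ℝ (u₀ t) (P.incl v) = inner ℝ x₀ (P.incl v)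
      - (∫ s in (0 : ℝ)..t, P.opA (P.toV (u₀ s)) v)
      - ∫ s in (0 : ℝ)..t, B (P.toV (u₀ s)) (P.toV (u₀ s)) v

/-- `Y ∈ C([0,T];H) ∩ L²([0,T];V)` solves the skeleton equation
`dY/dt + 𝒜Y + B(Y,u⁰) + B(u⁰,Y) = ∫_Z G(t,u⁰(t),z) φ(t,z) ν(dz)`, `Y(0) = 0`,
i.e. the integrated equation holds in `V'` for every `t ∈ [0,T]`. -/
structure IsSkeletonSolution {Z : Type*} [MeasurableSpace Z] (P : PosDefOperator H)
    (B : P.V →L[ℝ] P.V →L[ℝ] (P.V →L[ℝ] ℝ)) (T : ℝ) (ν : Measure Z) (G : ℝ → H → Z → H)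
    (u₀ : ℝ → H) (φ : Lp ℝ 2 (nuT T ν)) (Y : ℝ → H) : Prop where
  mem : P.MemCL2 T Y
  eqn : ∀ t ∈ Icc 0 T, ∀ v : P.V,
    inner ℝ (Y t) (P.incl v) =
      - (∫ s in (0 : ℝ)..t, P.opA (P.toV (Y s)) v)
      - (∫ s in (0 : ℝ)..t, B (P.toV (Y s)) (P.toV (u₀ s)) v)
      - (∫ s in (0 : ℝ)..t, B (P.toV (u₀ s)) (P.toV (Y s)) v)
      + ∫ s in (0 : ℝ)..t, inner ℝ (∫ z, φ (s, z) • G s (u₀ s) z ∂ν) (P.incl v)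

end Equations

end Hydro

end

/-!
The difference `X = Yⁿ - Y` of two skeleton solutions solves, with zero initial value, the linear
equation `X' + 𝒜X + B(X, u⁰) + B(u⁰, X) = fₙ`, where `fₙ(t) = ∫_Z g(t,z) (φₙ - φ)(t,z) ν(dz)` and
`g(t,z) = G(t, u⁰(t), z)`. The growth condition on `G` puts `g` into `L²(ν_T; H)`
(`AssumptionG.memLp_two`), so that `fₙ` is bounded in `L¹(0,T; H)`, and no better.

By the energy equality (`energy_equality`), antisymmetry of `B`, the interpolation inequality and
Grönwall's inequality, both `sup ‖X‖²` in `H` and the squared norm of `X` in `L²(0,T; V)` are at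
most a constant times `sup_t |∫₀ᵗ ⟪fₙ, X⟫|`, with a constant that depends on `u⁰` only
(`exists_stability_const`). As `|∫₀ᵗ ⟪fₙ, X⟫| ≤ sup ‖X‖ · ‖φₙ - φ‖ · ‖g‖`, this bounds `X` uniformly
in `n` (`exists_apriori_bound`).

It remains to see that `∫₀ᵗ ⟪fₙ, X⟫ = ∫_{[0,t] × Z} (φₙ - φ) ⟪g, X⟫ dν_T` tends to zero uniformly
in `t`. No compactness of `V ⊆ H` is available. By the uniform bound on `X`, it is enough to let
`g` range over functions `1_A v` with `v ∈ V`, whose span is dense in `L²(ν_T; H)`. For these the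
pairing is `∫₀ᵗ a ⟪v, X⟫ ds` with `a(s) = ∫_Z 1_A (φₙ - φ) dν`. The primitive of `a` tends to zero
uniformly, because the indicators of `A ∩ ([0,t] × Z)` form a compact subset of `L²(ν_T)`, and
`⟪v, X⟫` has a derivative bounded in `L¹(0,T)` by the equation, so an integration by parts concludes
(`eventually_forall_abs_integral_mul_inner_le`).

The energy equality itself is proved by time averages: the continuity of translations in
`L²(ℝ; V)` makes up for the missing regularity in time, and neither completeness of `V` nor
Bochner integrals with values in `V'` are used.
-/

noncomputable section

namespace Hydro

/-! ### Translation and averaging in time -/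

section Energy

theorem lintegral_enorm_mul_enorm_le {α E F : Type*} [MeasurableSpace α] {μ : Measure α}
    [NormedAddCommGroup E] [NormedAddCommGroup F] {f : α → E} {g : α → F}
    (hf : AEStronglyMeasurable f μ) (hg : AEStronglyMeasurable g μ) :
    ∫⁻ a, ‖f a‖ₑ * ‖g a‖ₑ ∂μ ≤ eLpNorm f 2 μ * eLpNorm g 2 μ := by
  have h := eLpNorm_smul_le_mul_eLpNorm (p := 2) (q := 2) (r := 1) (μ := μ) hg.norm hf.norm
  rw [eLpNorm_norm, eLpNorm_norm, eLpNorm_one_eq_lintegral_enorm] at h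
  refine le_trans (le_of_eq ?_) h
  refine lintegral_congr fun a => ?_
  simp [enorm_mul, enorm_norm]

/-- Translation is continuous in `L²(ℝ; E)`. -/
theorem tendsto_eLpNorm_translate_sub {E : Type*} [NormedAddCommGroup E] {x : ℝ → E}
    (hx : MemLp x 2 volume) :
    Tendsto (fun h : ℝ => eLpNorm (fun t => x (t + h) - x t) 2 volume) (𝓝 0) (𝓝 0) := by
  let g : ℝ → C(ℝ, ℝ) := fun h => ⟨fun t => t + h, by fun_prop⟩
  have hgm : ∀ h, MeasurePreserving (g h) volume volume := fun h =>
    measurePreserving_add_right volume h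
  have hg : Continuous g := by
    refine ContinuousMap.continuous_of_continuous_uncurry _ ?_
    simp only [g, Function.uncurry_def, ContinuousMap.coe_mk]
    fun_prop
  have hc := (Continuous.compMeasurePreservingLp (continuous_const (y := hx.toLp x)) hg hgm
    (by simp : (2 : ℝ≥0∞) ≠ ∞)).tendsto 0
  have h2 := (tendsto_iff_edist_tendsto_0.1 hc)
  refine h2.congr fun h => ?_
  rw [Lp.edist_def]
  refine eLpNorm_congr_ae ?_
  have e1 := Lp.coeFn_compMeasurePreserving (hx.toLp x) (hgm h)
  have e2 := Lp.coeFn_compMeasurePreserving (hx.toLp x) (hgm 0)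
  have e3 := (hgm h).quasiMeasurePreserving.ae_eq_comp hx.coeFn_toLp
  have e4 := (hgm 0).quasiMeasurePreserving.ae_eq_comp hx.coeFn_toLp
  filter_upwards [e1, e2, e3, e4] with t h1 h2 h3 h4
  simp only [Pi.sub_apply]
  rw [h1, h2, h3, h4]
  simp [g]

/-- Tonelli's theorem on the strip `{(t, r) | t < r ≤ t + h}`, in the coordinates `(t, r - t)`. -/
theorem lintegral_strip_eq {F : ℝ → ℝ → ℝ≥0∞} (hF : Measurable (Function.uncurry F)) (h : ℝ) :
    ∫⁻ t, ∫⁻ r in Ioc t (t + h), F t r = ∫⁻ θ in Ioc 0 h, ∫⁻ t, F t (t + θ) := by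
  have shift : ∀ t, ∫⁻ r in Ioc t (t + h), F t r = ∫⁻ θ in Ioc 0 h, F t (t + θ) := by
    intro t
    rw [← lintegral_indicator measurableSet_Ioc, ← lintegral_indicator measurableSet_Ioc,
      ← lintegral_add_left_eq_self _ t]
    refine lintegral_congr fun θ => ?_
    simp only [indicator, mem_Ioc, lt_add_iff_pos_right, add_le_add_iff_left]
  simp_rw [shift]
  refine lintegral_lintegral_swap (f := fun t θ => F t (t + θ)) ?_
  exact (hF.comp (measurable_fst.prodMk (measurable_fst.add measurable_snd))).aemeasurable

theorem lintegral_strip_mul_le {E F : Type*} [NormedAddCommGroup E] [NormedAddCommGroup F]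
    {w : ℝ → F} {x : ℝ → E} (hw : StronglyMeasurable w) (hx : StronglyMeasurable x)
    {h : ℝ} {η : ℝ≥0∞}
    (hη : ∀ θ ∈ Icc 0 h, eLpNorm (fun t => x (t + θ) - x t) 2 volume ≤ η) :
    ∫⁻ t, ∫⁻ r in Ioc t (t + h), ‖w r‖ₑ * ‖x (t + h) - x r‖ₑ + ‖w r‖ₑ * ‖x t - x r‖ₑ ≤
      ENNReal.ofReal h * (2 * (eLpNorm w 2 volume * η)) := by
  have m1 : Measurable fun p : ℝ × ℝ => ‖w p.2‖ₑ :=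
    (hw.comp_measurable measurable_snd).enorm
  have m2 : Measurable fun p : ℝ × ℝ => ‖x (p.1 + h) - x p.2‖ₑ :=
    ((hx.comp_measurable (measurable_fst.add_const h)).sub
      (hx.comp_measurable measurable_snd)).enorm
  have m3 : Measurable fun p : ℝ × ℝ => ‖x p.1 - x p.2‖ₑ :=
    ((hx.comp_measurable measurable_fst).sub (hx.comp_measurable measurable_snd)).enorm
  rw [lintegral_strip_eq
    (F := fun t r => ‖w r‖ₑ * ‖x (t + h) - x r‖ₑ + ‖w r‖ₑ * ‖x t - x r‖ₑ)
    ((m1.mul m2).add (m1.mul m3))]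
  have hwθ : ∀ θ : ℝ, StronglyMeasurable fun t => w (t + θ) := fun θ =>
    hw.comp_measurable (measurable_id.add_const θ)
  have hxθ : ∀ θ : ℝ, StronglyMeasurable fun t => x (t + θ) := fun θ =>
    hx.comp_measurable (measurable_id.add_const θ)
  have key : ∀ θ ∈ Ioc 0 h, ∫⁻ t, ‖w (t + θ)‖ₑ * ‖x (t + h) - x (t + θ)‖ₑ
      + ‖w (t + θ)‖ₑ * ‖x t - x (t + θ)‖ₑ ≤ 2 * (eLpNorm w 2 volume * η) := by
    intro θ hθ
    have ew : eLpNorm (fun t => w (t + θ)) 2 volume = eLpNorm w 2 volume :=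
      eLpNorm_comp_measurePreserving hw.aestronglyMeasurable
        (measurePreserving_add_right volume θ)
    have b1 : ∫⁻ t, ‖w (t + θ)‖ₑ * ‖x (t + h) - x (t + θ)‖ₑ ≤ eLpNorm w 2 volume * η := by
      refine (lintegral_enorm_mul_enorm_le (f := fun t => w (t + θ))
        (g := fun t => x (t + h) - x (t + θ)) (hwθ θ).aestronglyMeasurable
        ((hxθ h).sub (hxθ θ)).aestronglyMeasurable).trans ?_
      rw [ew]
      gcongr
      have := eLpNorm_comp_measurePreserving (p := 2)
        (g := fun t => x (t + (h - θ)) - x t) ((hxθ (h - θ)).sub hx).aestronglyMeasurable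
        (measurePreserving_add_right volume θ)
      refine le_trans (le_of_eq ?_) (hη (h - θ) ⟨by linarith [hθ.2], by linarith [hθ.1]⟩)
      rw [← this]
      congr 1
      ext t
      simp only [Function.comp]
      congr 2
      ring
    have b2 : ∫⁻ t, ‖w (t + θ)‖ₑ * ‖x t - x (t + θ)‖ₑ ≤ eLpNorm w 2 volume * η := by
      refine (lintegral_enorm_mul_enorm_le (f := fun t => w (t + θ))
        (g := fun t => x t - x (t + θ)) (hwθ θ).aestronglyMeasurable
        (hx.sub (hxθ θ)).aestronglyMeasurable).trans ?_
      rw [ew]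
      gcongr
      refine le_trans (le_of_eq ?_) (hη θ ⟨hθ.1.le, hθ.2⟩)
      exact eLpNorm_sub_comm x _ _ _
    rw [lintegral_add_left]
    · rw [two_mul]; exact add_le_add b1 b2
    · exact (hwθ θ).enorm.mul ((hxθ h).sub (hxθ θ)).enorm
  calc _ ≤ ∫⁻ θ in Ioc 0 h, 2 * (eLpNorm w 2 volume * η) :=
        setLIntegral_mono measurable_const key
    _ = _ := by rw [setLIntegral_const, Real.volume_Ioc, sub_zero, mul_comm]

theorem lintegral_strip_enorm {E : Type*} [NormedAddCommGroup E]
    {f : ℝ → E} (hf : StronglyMeasurable f) (h : ℝ) :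
    ∫⁻ t, ∫⁻ r in Ioc t (t + h), ‖f r‖ₑ = ENNReal.ofReal h * ∫⁻ t, ‖f t‖ₑ := by
  rw [lintegral_strip_eq (F := fun _ r => ‖f r‖ₑ) (hf.comp_measurable measurable_snd).enorm]
  have : ∀ θ : ℝ, ∫⁻ t, ‖f (t + θ)‖ₑ = ∫⁻ t, ‖f t‖ₑ := fun θ =>
    lintegral_add_right_eq_self (fun t => ‖f t‖ₑ) θ
  simp_rw [this]
  rw [setLIntegral_const, Real.volume_Ioc, sub_zero, mul_comm]

/-- A continuous function whose increments over short time steps `h` are `o(h)` on average takes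
the same value at both ends. -/
theorem eq_of_lintegral_increment_le {Φ : ℝ → ℝ} {T b : ℝ} (hb0 : 0 ≤ b) (hbT : b < T)
    (hΦ : ContinuousOn Φ (Icc 0 T))
    (H : ∀ ε : ℝ, 0 < ε → ∀ᶠ h in 𝓝[>] (0 : ℝ),
      ∫⁻ t in Ioc 0 b, ‖Φ (t + h) - Φ t‖ₑ ≤ ENNReal.ofReal (h * ε)) :
    Φ b = Φ 0 := by
  by_contra hne
  set D := |Φ b - Φ 0| with hD
  have hDpos : 0 < D := abs_pos.2 (sub_ne_zero.2 hne)
  have hT : 0 < T := hb0.trans_lt hbT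
  obtain ⟨δ, hδ, hδ'⟩ := Metric.uniformContinuousOn_iff_le.1
    (isCompact_Icc.uniformContinuousOn_of_continuous hΦ) (D / 4) (by positivity)
  have ev : ∀ᶠ h in 𝓝[>] (0 : ℝ), h ∈ Ioo 0 (min δ (T - b)) :=
    Ioo_mem_nhdsGT (lt_min hδ (by linarith))
  obtain ⟨h, hh, ⟨h0, h1⟩⟩ := ((H (D / 4) (by positivity)).and ev).exists
  have hhδ : h < δ := h1.trans_le (min_le_left _ _)
  have hhT : h < T - b := h1.trans_le (min_le_right _ _)
  have ii : ∀ c d, 0 ≤ c → c ≤ d → d ≤ T → IntervalIntegrable Φ volume c d := by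
    intro c d hc hcd hd
    refine ContinuousOn.intervalIntegrable ?_
    rw [uIcc_of_le hcd]
    exact hΦ.mono (Icc_subset_Icc hc hd)
  have e1 : ∫ t in (0 : ℝ)..b, Φ (t + h) - Φ t =
      (∫ t in b..(b + h), Φ t) - ∫ t in (0 : ℝ)..h, Φ t := by
    have i1 : IntervalIntegrable (fun t => Φ (t + h)) volume 0 b := by
      simpa using (ii h (b + h) h0.le (by linarith) (by linarith)).comp_add_right h
    rw [intervalIntegral.integral_sub i1 (ii 0 b le_rfl hb0 hbT.le),
      intervalIntegral.integral_comp_add_right (fun t => Φ t), zero_add]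
    have k1 := intervalIntegral.integral_add_adjacent_intervals
      (ii 0 h le_rfl h0.le (by linarith)) (ii h (b + h) h0.le (by linarith) (by linarith))
    have k2 := intervalIntegral.integral_add_adjacent_intervals
      (ii 0 b le_rfl hb0 hbT.le) (ii b (b + h) hb0 (by linarith) (by linarith))
    linarith
  have e2 : |∫ t in (0 : ℝ)..b, Φ (t + h) - Φ t| ≤ h * (D / 4) := by
    rw [intervalIntegral.integral_of_le hb0]
    have := (enorm_integral_le_lintegral_enorm (μ := volume.restrict (Ioc 0 b))
      (fun t => Φ (t + h) - Φ t)).trans hh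
    rw [Real.enorm_eq_ofReal_abs] at this
    exact (ENNReal.ofReal_le_ofReal_iff (by positivity)).1 this
  have near : ∀ c, 0 ≤ c → c + h ≤ T → |(∫ t in c..(c + h), Φ t) - h * Φ c| ≤ h * (D / 4) := by
    intro c hc hcT
    have : (∫ t in c..(c + h), Φ t) - h * Φ c = ∫ t in c..(c + h), (Φ t - Φ c) := by
      rw [intervalIntegral.integral_sub (ii c _ hc (by linarith) hcT) (by simp)]
      simp
    rw [this]
    have := intervalIntegral.norm_integral_le_of_norm_le_const (a := c) (b := c + h)
      (f := fun t => Φ t - Φ c) (C := D / 4) (by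
        intro t ht
        rw [uIoc_of_le (by linarith)] at ht
        rw [← dist_eq_norm]
        refine hδ' t ⟨by linarith [ht.1], by linarith [ht.2]⟩ c ⟨hc, by linarith⟩ ?_
        rw [Real.dist_eq, abs_le]
        constructor <;> linarith [ht.1, ht.2])
    rw [Real.norm_eq_abs] at this
    simpa [abs_of_pos h0, mul_comm] using this
  have n1 := near b hb0 (by linarith)
  have n2 := near 0 le_rfl (by linarith)
  rw [zero_add] at n2
  rw [e1] at e2
  have hfin : |h * (Φ b - Φ 0)| ≤ h * (3 * (D / 4)) := by
    rw [abs_le] at *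
    constructor <;> nlinarith
  rw [abs_mul, abs_of_pos h0, ← hD] at hfin
  have := le_of_mul_le_mul_left hfin h0
  linarith

end Energy

/-! ### The energy equality -/

section Energy

variable {V H : Type*} [NormedAddCommGroup V] [NormedSpace ℝ V]
  [NormedAddCommGroup H] [InnerProductSpace ℝ H]

theorem integrable_apply_of_memLp_two {α : Type*} [MeasurableSpace α] {μ : Measure α}
    {w : α → V →L[ℝ] ℝ} {x : α → V} (hw : MemLp w 2 μ) (hx : MemLp x 2 μ) :
    Integrable (fun a => w a (x a)) μ := by
  refine (MemLp.integrable_mul hw.norm hx.norm).mono' ?_ ?_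
  · exact isBoundedBilinearMap_apply.continuous.comp_aestronglyMeasurable
      (hw.1.prodMk hx.1)
  · exact Eventually.of_forall fun a => (w a).le_opNorm (x a)

theorem integrable_inner_of_continuousOn {f X : ℝ → H} {T : ℝ}
    (hf : IntegrableOn f (Icc 0 T)) (hX : ContinuousOn X (Icc 0 T)) :
    IntegrableOn (fun r => inner ℝ (f r) (X r)) (Icc 0 T) := by
  obtain ⟨M, hM⟩ := isCompact_Icc.exists_bound_of_continuousOn hX
  refine (hf.norm.const_mul M).mono' ?_ ?_
  · exact hf.1.inner (hX.aestronglyMeasurable measurableSet_Icc)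
  · filter_upwards [ae_restrict_mem measurableSet_Icc] with r hr
    rw [mul_comm]
    exact (norm_inner_le_norm _ _).trans (mul_le_mul_of_nonneg_left (hM r hr) (norm_nonneg _))

/-- The energy equality, for representatives defined on the whole line. Writing
`‖X (t+h)‖² - ‖X t‖² = ⟪X (t+h) - X t, X (t+h) + X t⟫` and inserting the equation, tested with
`x (t+h) + x t`, the error against the claimed identity is controlled, on average in `t`, by the
`L²`-modulus of continuity of `x` and the uniform modulus of continuity of `X`. -/
theorem energy_equality_aux (i : V →L[ℝ] H) {T : ℝ} {X f : ℝ → H} {x : ℝ → V}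
    {w : ℝ → V →L[ℝ] ℝ} (hX : ContinuousOn X (Icc 0 T))
    (hxm : StronglyMeasurable x) (hx : MemLp x 2 volume)
    (hwm : StronglyMeasurable w) (hw : MemLp w 2 volume)
    (hfm : StronglyMeasurable f) (hf : Integrable f volume)
    (hxX : ∀ᵐ t, t ∈ Icc 0 T → i (x t) = X t)
    (heq : ∀ t ∈ Icc 0 T, ∀ v : V, inner ℝ (X t) (i v) = inner ℝ (X 0) (i v) +
      ∫ r in (0 : ℝ)..t, (w r v + inner ℝ (f r) (i v)))
    {b : ℝ} (hb : b ∈ Ico 0 T) :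
    ‖X b‖ ^ 2 = ‖X 0‖ ^ 2 + ∫ r in (0 : ℝ)..b, 2 * (w r (x r) + inner ℝ (f r) (X r)) := by
  have hT : 0 < T := hb.1.trans_lt hb.2
  have iwx : Integrable (fun r => w r (x r)) volume := integrable_apply_of_memLp_two hw hx
  have ifX : IntegrableOn (fun r => inner ℝ (f r) (X r)) (Icc 0 T) :=
    integrable_inner_of_continuousOn hf.integrableOn hX
  have iq : IntegrableOn (fun r => 2 * (w r (x r) + inner ℝ (f r) (X r))) (Icc 0 T) :=
    (iwx.integrableOn.add ifX).const_mul 2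
  have iwv : ∀ (v : V) (c d : ℝ), IntervalIntegrable (fun r => w r v) volume c d := by
    intro v c d
    have : IsFiniteMeasure (volume.restrict (uIcc c d)) :=
      ⟨by rw [Measure.restrict_apply_univ]; exact isCompact_uIcc.measure_lt_top⟩
    have : IntegrableOn w (uIcc c d) :=
      (hw.restrict _).integrable (by norm_num)
    exact IntegrableOn.intervalIntegrable
      ((ContinuousLinearMap.apply ℝ ℝ v).integrable_comp this)
  have ifv : ∀ (u : H) (c d : ℝ), IntervalIntegrable (fun r => inner ℝ (f r) u) volume c d :=
    fun u c d => (hf.inner_const u).intervalIntegrable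
  have iqi : ∀ c d, 0 ≤ c → c ≤ d → d ≤ T → IntervalIntegrable
      (fun r => 2 * (w r (x r) + inner ℝ (f r) (X r))) volume c d := by
    intro c d hc hcd hd
    refine IntegrableOn.intervalIntegrable ?_
    rw [uIcc_of_le hcd]
    exact iq.mono_set (Icc_subset_Icc hc hd)
  set Φ : ℝ → ℝ := fun t =>
    ‖X t‖ ^ 2 - ∫ r in (0 : ℝ)..t, 2 * (w r (x r) + inner ℝ (f r) (X r)) with hΦdef
  have hΦ : ContinuousOn Φ (Icc 0 T) := by
    refine (hX.norm.pow 2).sub ?_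
    have := intervalIntegral.continuousOn_primitive_interval (a := 0) (b := T)
      (f := fun r => 2 * (w r (x r) + inner ℝ (f r) (X r))) (μ := volume)
      (by rw [uIcc_of_le hT.le]; exact iq)
    rwa [uIcc_of_le hT.le] at this
  have hmain : Φ b = Φ 0 := by
    refine eq_of_lintegral_increment_le hb.1 hb.2 hΦ ?_
    intro ε hε
    -- `η` bounds the `L²`-modulus of `x`, `ω` the uniform modulus of `X`.
    set W : ℝ := (eLpNorm w 2 volume).toReal with hW
    set N : ℝ := (∫⁻ t, ‖f t‖ₑ).toReal with hN
    have hWn : 0 ≤ W := ENNReal.toReal_nonneg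
    have hNn : 0 ≤ N := ENNReal.toReal_nonneg
    have eW : eLpNorm w 2 volume = ENNReal.ofReal W :=
      (ENNReal.ofReal_toReal hw.2.ne).symm
    have eN : ∫⁻ t, ‖f t‖ₑ = ENNReal.ofReal N :=
      (ENNReal.ofReal_toReal hf.2.ne).symm
    set η : ℝ := ε / (4 * (W + 1)) with hη
    set ω : ℝ := ε / (4 * (N + 1)) with hω
    have hηpos : 0 < η := by positivity
    have hωpos : 0 < ω := by positivity
    have t1 := (tendsto_eLpNorm_translate_sub hx).eventually_lt_const
      (u := ENNReal.ofReal η) (by simpa using hηpos)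
    obtain ⟨δ₁, hδ₁, hδ₁'⟩ := Metric.eventually_nhds_iff.1 t1
    obtain ⟨δ₂, hδ₂, hδ₂'⟩ := Metric.uniformContinuousOn_iff_le.1
      (isCompact_Icc.uniformContinuousOn_of_continuous hX) ω hωpos
    have ev : ∀ᶠ h in 𝓝[>] (0 : ℝ), h ∈ Ioo 0 (min (min δ₁ δ₂) (T - b)) :=
      Ioo_mem_nhdsGT (lt_min (lt_min hδ₁ hδ₂) (by linarith [hb.2]))
    filter_upwards [ev] with h hh
    have h0 : 0 < h := hh.1
    have hh1 : h < δ₁ := hh.2.trans_le ((min_le_left _ _).trans (min_le_left _ _))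
    have hh2 : h < δ₂ := hh.2.trans_le ((min_le_left _ _).trans (min_le_right _ _))
    have hhT : h < T - b := hh.2.trans_le (min_le_right _ _)
    have hxX' : ∀ᵐ t, t + h ∈ Icc 0 T → i (x (t + h)) = X (t + h) :=
      (measurePreserving_add_right volume h).quasiMeasurePreserving.ae hxX
    have pt : ∀ᵐ t ∂(volume.restrict (Ioc 0 b)), ‖Φ (t + h) - Φ t‖ₑ ≤
        (∫⁻ r in Ioc t (t + h), ‖w r‖ₑ * ‖x (t + h) - x r‖ₑ + ‖w r‖ₑ * ‖x t - x r‖ₑ) +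
        ∫⁻ r in Ioc t (t + h), ENNReal.ofReal (2 * ω) * ‖f r‖ₑ := by
      rw [ae_restrict_iff' measurableSet_Ioc]
      filter_upwards [hxX, hxX'] with t h1 h2 ht
      have ht1 : t ∈ Icc 0 T := ⟨ht.1.le, ht.2.trans hb.2.le⟩
      have ht2 : t + h ∈ Icc 0 T := ⟨by linarith [ht.1], by linarith [ht.2]⟩
      have h1 := h1 ht1
      have h2 := h2 ht2
      have htt : t ≤ t + h := by linarith
      have e1 : inner ℝ (X (t + h) - X t) (i (x (t + h) + x t)) =
          ∫ r in t..(t + h), (w r (x (t + h) + x t) + inner ℝ (f r) (i (x (t + h) + x t))) := by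
        rw [inner_sub_left, heq _ ht2, heq _ ht1]
        have := intervalIntegral.integral_add_adjacent_intervals
          (((iwv (x (t + h) + x t) 0 t)).add (ifv (i (x (t + h) + x t)) 0 t))
          (((iwv (x (t + h) + x t) t (t + h))).add (ifv (i (x (t + h) + x t)) t (t + h)))
        linarith
      have e2 : ‖X (t + h)‖ ^ 2 - ‖X t‖ ^ 2 =
          inner ℝ (X (t + h) - X t) (i (x (t + h) + x t)) := by
        rw [map_add, h1, h2, inner_sub_left, inner_add_right, inner_add_right,
          real_inner_self_eq_norm_sq, real_inner_self_eq_norm_sq, real_inner_comm (X t)]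
        ring
      have e3 : Φ (t + h) - Φ t = ∫ r in t..(t + h),
          ((w r (x (t + h) + x t) + inner ℝ (f r) (i (x (t + h) + x t)))
            - 2 * (w r (x r) + inner ℝ (f r) (X r))) := by
        rw [intervalIntegral.integral_sub ((iwv _ _ _).add (ifv _ _ _))
          (iqi t (t + h) ht1.1 htt ht2.2), ← e1, ← e2]
        have := intervalIntegral.integral_add_adjacent_intervals
          (iqi 0 t le_rfl ht1.1 ht1.2) (iqi t (t + h) ht1.1 htt ht2.2)
        simp only [hΦdef]
        linarith
      rw [e3, intervalIntegral.integral_of_le htt]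
      refine (enorm_integral_le_lintegral_enorm _).trans ?_
      rw [← lintegral_add_left]
      · refine setLIntegral_mono_ae' measurableSet_Ioc ?_
        refine Eventually.of_forall fun r hr => ?_
        have hrT : r ∈ Icc 0 T := ⟨by linarith [hr.1, ht.1], by linarith [hr.2, ht2.2]⟩
        have split : (w r (x (t + h) + x t) + inner ℝ (f r) (i (x (t + h) + x t)))
            - 2 * (w r (x r) + inner ℝ (f r) (X r)) =
            (w r (x (t + h) - x r) + w r (x t - x r)) +
              inner ℝ (f r) ((X (t + h) - X r) + (X t - X r)) := by
          rw [map_add i, h1, h2]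
          simp only [map_add, map_sub, inner_add_right, inner_sub_right]
          ring
        rw [split]
        refine (enorm_add_le _ _).trans (add_le_add ((enorm_add_le _ _).trans
          (add_le_add ((w r).le_opENorm _) ((w r).le_opENorm _))) ?_)
        rw [← ofReal_norm, ← ofReal_norm,
          ← ENNReal.ofReal_mul (by positivity)]
        refine ENNReal.ofReal_le_ofReal ((norm_inner_le_norm _ _).trans ?_)
        rw [mul_comm]
        refine mul_le_mul_of_nonneg_right ?_ (norm_nonneg _)
        refine (norm_add_le _ _).trans ?_
        have a1 : ‖X (t + h) - X r‖ ≤ ω := by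
          rw [← dist_eq_norm]
          refine hδ₂' _ ht2 _ hrT ?_
          rw [Real.dist_eq, abs_le]
          constructor <;> linarith [hr.1, hr.2]
        have a2 : ‖X t - X r‖ ≤ ω := by
          rw [← dist_eq_norm]
          refine hδ₂' _ ht1 _ hrT ?_
          rw [Real.dist_eq, abs_le]
          constructor <;> linarith [hr.1, hr.2]
        linarith
      · exact (hwm.enorm.mul (stronglyMeasurable_const.sub hxm).enorm).add
          (hwm.enorm.mul (stronglyMeasurable_const.sub hxm).enorm)
    have s1 := lintegral_strip_mul_le hwm hxm (h := h) (η := ENNReal.ofReal η) (fun θ hθ => by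
      refine (hδ₁' ?_).le
      rw [Real.dist_eq, sub_zero, abs_of_nonneg hθ.1]
      exact hθ.2.trans_lt hh1)
    have s2 := lintegral_strip_enorm hfm h
    have m2 : Measurable fun t => ∫⁻ r in Ioc t (t + h), ‖f r‖ₑ := by
      have : (fun t => ∫⁻ r in Ioc t (t + h), ‖f r‖ₑ) =
          fun t => ∫⁻ r, {p : ℝ × ℝ | p.1 < p.2 ∧ p.2 ≤ p.1 + h}.indicator
            (fun p => ‖f p.2‖ₑ) (t, r) := by
        ext t
        rw [← lintegral_indicator measurableSet_Ioc]
        rfl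
      rw [this]
      refine Measurable.lintegral_prod_right' ?_
      refine (hfm.comp_measurable measurable_snd).enorm.indicator ?_
      exact (measurableSet_lt measurable_fst measurable_snd).inter
        (measurableSet_le measurable_snd (measurable_fst.add_const h))
    calc ∫⁻ t in Ioc 0 b, ‖Φ (t + h) - Φ t‖ₑ
        ≤ ∫⁻ t in Ioc 0 b, ((∫⁻ r in Ioc t (t + h), ‖w r‖ₑ * ‖x (t + h) - x r‖ₑ
            + ‖w r‖ₑ * ‖x t - x r‖ₑ) +
          ENNReal.ofReal (2 * ω) * ∫⁻ r in Ioc t (t + h), ‖f r‖ₑ) := by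
          refine lintegral_mono_ae ?_
          filter_upwards [pt] with t ht
          rwa [lintegral_const_mul _ hfm.enorm] at ht
      _ ≤ ∫⁻ t, ((∫⁻ r in Ioc t (t + h), ‖w r‖ₑ * ‖x (t + h) - x r‖ₑ
            + ‖w r‖ₑ * ‖x t - x r‖ₑ) +
          ENNReal.ofReal (2 * ω) * ∫⁻ r in Ioc t (t + h), ‖f r‖ₑ) :=
          lintegral_mono' Measure.restrict_le_self le_rfl
      _ ≤ ENNReal.ofReal h * (2 * (eLpNorm w 2 volume * ENNReal.ofReal η)) +
          ENNReal.ofReal (2 * ω) * (ENNReal.ofReal h * ∫⁻ t, ‖f t‖ₑ) := by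
          rw [lintegral_add_right _ (m2.const_mul _), lintegral_const_mul _ m2, s2]
          gcongr
      _ ≤ ENNReal.ofReal (h * ε) := by
          rw [eW, eN, ← ENNReal.ofReal_mul hWn, ← ENNReal.ofReal_mul h0.le,
            ← ENNReal.ofReal_mul (by positivity), ← ENNReal.ofReal_ofNat 2,
            ← ENNReal.ofReal_mul (by norm_num), ← ENNReal.ofReal_mul h0.le,
            ← ENNReal.ofReal_add (by positivity) (by positivity)]
          refine ENNReal.ofReal_le_ofReal ?_
          have q1 : W * η ≤ ε / 4 := by
            rw [hη, mul_div_assoc', div_le_div_iff₀ (by positivity) (by norm_num)]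
            nlinarith
          have q2 : ω * N ≤ ε / 4 := by
            rw [hω, div_mul_eq_mul_div, div_le_div_iff₀ (by positivity) (by norm_num)]
            nlinarith
          nlinarith
  simp only [hΦdef, intervalIntegral.integral_same] at hmain
  linarith

theorem exists_stronglyMeasurable_extension {α E : Type*} [MeasurableSpace α] {μ : Measure α}
    [NormedAddCommGroup E] {s : Set α} (hs : MeasurableSet s) {p : ℝ≥0∞} {x : α → E}
    (hx : MemLp x p (μ.restrict s)) :
    ∃ x' : α → E, StronglyMeasurable x' ∧ (∀ᵐ t ∂μ, t ∈ s → x' t = x t) ∧ MemLp x' p μ := by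
  refine ⟨s.indicator (hx.1.mk x), hx.1.stronglyMeasurable_mk.indicator hs, ?_,
    (memLp_indicator_iff_restrict hs).2 (hx.ae_eq hx.1.ae_eq_mk)⟩
  have := hx.1.ae_eq_mk
  rw [Filter.EventuallyEq, ae_restrict_iff' hs] at this
  filter_upwards [this] with t ht hts
  rw [indicator_of_mem hts, ← ht hts]

/-- **Energy equality.** Let `X ∈ C([0,T]; H)` have a representative `x ∈ L²(0,T; V)`, and let
`X' = w + f` weakly against the elements of `V`, with `w ∈ L²(0,T; V')` and `f ∈ L¹(0,T; H)`. Then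
`‖X‖²` is the primitive of `2 ⟨w, x⟩ + 2 ⟪f, X⟫`. -/
theorem energy_equality (i : V →L[ℝ] H) {T : ℝ} (hT : 0 < T) {X f : ℝ → H} {x : ℝ → V}
    {w : ℝ → V →L[ℝ] ℝ} (hX : ContinuousOn X (Icc 0 T))
    (hx : MemLp x 2 (volume.restrict (Icc 0 T))) (hw : MemLp w 2 (volume.restrict (Icc 0 T)))
    (hf : IntegrableOn f (Icc 0 T))
    (hxX : ∀ᵐ t ∂volume.restrict (Icc 0 T), i (x t) = X t)
    (heq : ∀ t ∈ Icc 0 T, ∀ v : V, inner ℝ (X t) (i v) = inner ℝ (X 0) (i v) +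
      ∫ r in (0 : ℝ)..t, (w r v + inner ℝ (f r) (i v)))
    {b : ℝ} (hb : b ∈ Icc 0 T) :
    ‖X b‖ ^ 2 = ‖X 0‖ ^ 2 + ∫ r in (0 : ℝ)..b, 2 * (w r (x r) + inner ℝ (f r) (X r)) := by
  have iq : IntegrableOn (fun r => 2 * (w r (x r) + inner ℝ (f r) (X r))) (Icc 0 T) :=
    ((integrable_apply_of_memLp_two hw hx).add (integrable_inner_of_continuousOn hf hX)).const_mul 2
  suffices hs : EqOn (fun b => ‖X b‖ ^ 2)
      (fun b => ‖X 0‖ ^ 2 + ∫ r in (0 : ℝ)..b, 2 * (w r (x r) + inner ℝ (f r) (X r)))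
      (Ico 0 T) by
    refine hs.of_subset_closure (hX.norm.pow 2) (continuousOn_const.add ?_) Ico_subset_Icc_self
      (closure_Ico hT.ne).ge hb
    have := intervalIntegral.continuousOn_primitive_interval (a := 0) (b := T)
      (f := fun r => 2 * (w r (x r) + inner ℝ (f r) (X r))) (μ := volume)
      (by rw [uIcc_of_le hT.le]; exact iq)
    rwa [uIcc_of_le hT.le] at this
  intro b hb
  obtain ⟨x', hxm, ex, hx2⟩ := exists_stronglyMeasurable_extension measurableSet_Icc hx
  obtain ⟨w', hwm, ew, hw2⟩ := exists_stronglyMeasurable_extension measurableSet_Icc hw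
  obtain ⟨f', hfm, ef, hf2⟩ := exists_stronglyMeasurable_extension measurableSet_Icc
    (memLp_one_iff_integrable.2 hf)
  have sub : ∀ {t r : ℝ}, t ∈ Icc 0 T → r ∈ uIoc 0 t → r ∈ Icc 0 T := by
    intro t r ht hr
    rw [uIoc_of_le ht.1] at hr
    exact ⟨hr.1.le, hr.2.trans ht.2⟩
  rw [ae_restrict_iff' measurableSet_Icc] at hxX
  have main := energy_equality_aux i (X := X) (f := f') (x := x') (w := w') hX
    hxm hx2 hwm hw2 hfm (memLp_one_iff_integrable.1 hf2)
    (by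
      filter_upwards [ex, hxX] with t h1 h2 ht
      rw [h1 ht, h2 ht])
    (by
      intro t ht v
      rw [heq t ht v]
      congr 1
      refine intervalIntegral.integral_congr_ae ?_
      filter_upwards [ew, ef] with r h1 h2 hr
      rw [h1 (sub ht hr), h2 (sub ht hr)])
    hb
  simp only
  rw [main]
  congr 1
  refine intervalIntegral.integral_congr_ae ?_
  filter_upwards [ew, ef, ex] with r h1 h2 h3 hr
  have hr := sub (Ico_subset_Icc_self hb) hr
  rw [h1 hr, h2 hr, h3 hr]

end Energy

/-! ### Grönwall's inequality, integration by parts, weak convergence on compact sets -/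

/-- **Grönwall's inequality** with an integrable kernel. The constant depends on the kernel and
on `T` only; it is built up over finitely many time steps on each of which `k` has integral at
most `1/2`. -/
theorem exists_gronwall_const {k : ℝ → ℝ} {T : ℝ} (hT : 0 ≤ T) (hk : IntegrableOn k (Icc 0 T))
    (hk0 : ∀ t, 0 ≤ k t) :
    ∃ C : ℝ, 0 ≤ C ∧ ∀ (y : ℝ → ℝ) (a : ℝ), ContinuousOn y (Icc 0 T) → 0 ≤ a →
      (∀ t ∈ Icc 0 T, y t ≤ a + ∫ s in (0 : ℝ)..t, k s * y s) →
      ∀ t ∈ Icc 0 T, y t ≤ C * a := by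
  have iik : ∀ c d, 0 ≤ c → c ≤ d → d ≤ T → IntervalIntegrable k volume c d := by
    intro c d hc hcd hd
    refine IntegrableOn.intervalIntegrable ?_
    rw [uIcc_of_le hcd]
    exact hk.mono_set (Icc_subset_Icc hc hd)
  have hK : ContinuousOn (fun t => ∫ s in (0 : ℝ)..t, k s) (Icc 0 T) := by
    have := intervalIntegral.continuousOn_primitive_interval (a := 0) (b := T)
      (f := k) (μ := volume) (by rw [uIcc_of_le hT]; exact hk)
    rwa [uIcc_of_le hT] at this
  obtain ⟨δ, hδ, hδ'⟩ := Metric.uniformContinuousOn_iff_le.1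
    (isCompact_Icc.uniformContinuousOn_of_continuous hK) (1 / 2) (by norm_num)
  have small : ∀ c d, 0 ≤ c → c ≤ d → d ≤ T → d ≤ c + δ → ∫ s in c..d, k s ≤ 1 / 2 := by
    intro c d hc hcd hd hcδ
    have h1 := hδ' d ⟨hc.trans hcd, hd⟩ c ⟨hc, hcd.trans hd⟩
      (by rw [Real.dist_eq, abs_le]; constructor <;> linarith)
    have h2 := intervalIntegral.integral_add_adjacent_intervals
      (iik 0 c le_rfl hc (hcd.trans hd)) (iik c d hc hcd hd)
    rw [Real.dist_eq] at h1
    linarith [le_abs_self ((∫ s in (0 : ℝ)..d, k s) - ∫ s in (0 : ℝ)..c, k s)]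
  set K := ∫ s in (0 : ℝ)..T, k s with hKdef
  have hK0 : 0 ≤ K := intervalIntegral.integral_nonneg hT fun t _ => hk0 t
  have step : ∀ n : ℕ, ∃ C : ℝ, 0 ≤ C ∧ ∀ (y : ℝ → ℝ) (a : ℝ), ContinuousOn y (Icc 0 T) → 0 ≤ a →
      (∀ t ∈ Icc 0 T, y t ≤ a + ∫ s in (0 : ℝ)..t, k s * y s) →
      ∀ t ∈ Icc 0 T, t ≤ n * δ → y t ≤ C * a := by
    intro n
    induction n with
    | zero =>
      refine ⟨1, zero_le_one, fun y a _ _ H t ht htn => ?_⟩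
      have : t = 0 := le_antisymm (by simpa using htn) ht.1
      subst this
      simpa using H 0 ht
    | succ n ih =>
      obtain ⟨C, hC, hCy⟩ := ih
      refine ⟨C + 2 * (1 + C * K), by positivity, fun y a hy ha H t ht htn => ?_⟩
      have old := hCy y a hy ha H
      by_cases htn' : t ≤ n * δ
      · refine (old t ht htn').trans ?_
        have : 0 ≤ 2 * (1 + C * K) := by positivity
        nlinarith
      have hn0 : (0 : ℝ) ≤ n * δ := by positivity
      have hle : (n : ℝ) * δ ≤ t := (not_le.1 htn').le
      have hnT : (n : ℝ) * δ ≤ T := hle.trans ht.2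
      obtain ⟨τ, hτ, hmax⟩ := (isCompact_Icc (a := (n : ℝ) * δ) (b := t)).exists_isMaxOn
        ⟨t, hle, le_rfl⟩ (hy.mono (Icc_subset_Icc hn0 ht.2))
      have hτT : τ ≤ T := hτ.2.trans ht.2
      have iky : ∀ c d, 0 ≤ c → c ≤ d → d ≤ T →
          IntervalIntegrable (fun s => k s * y s) volume c d := by
        intro c d hc hcd hd
        refine (iik c d hc hcd hd).mul_continuousOn ?_
        rw [uIcc_of_le hcd]
        exact hy.mono (Icc_subset_Icc hc hd)
      -- `y` is not assumed nonnegative, and `∫ k ≤ 1/2` is multiplied by `y τ` below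
      by_cases hneg : y τ ≤ 0
      · have : y t ≤ y τ := hmax ⟨hle, le_rfl⟩
        have : 0 ≤ (C + 2 * (1 + C * K)) * a := by positivity
        linarith
      have b1 : ∫ s in (0 : ℝ)..(n * δ), k s * y s ≤ K * (C * a) := by
        calc ∫ s in (0 : ℝ)..(n * δ), k s * y s ≤ ∫ s in (0 : ℝ)..(n * δ), k s * (C * a) := by
              refine intervalIntegral.integral_mono_on hn0 (iky _ _ le_rfl hn0 hnT)
                ((iik _ _ le_rfl hn0 hnT).mul_const _) fun s hs => ?_
              exact mul_le_mul_of_nonneg_left (old s ⟨hs.1, hs.2.trans hnT⟩ hs.2) (hk0 s)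
          _ = (∫ s in (0 : ℝ)..(n * δ), k s) * (C * a) := by
              rw [intervalIntegral.integral_mul_const]
          _ ≤ K * (C * a) := by
              refine mul_le_mul_of_nonneg_right ?_ (by positivity)
              have := intervalIntegral.integral_add_adjacent_intervals
                (iik 0 _ le_rfl hn0 hnT) (iik _ T hn0 hnT le_rfl)
              have h2 : 0 ≤ ∫ s in (n * δ)..T, k s :=
                intervalIntegral.integral_nonneg hnT fun t _ => hk0 t
              linarith
      have b2 : ∫ s in (n * δ)..τ, k s * y s ≤ 1 / 2 * y τ := by
        calc ∫ s in (n * δ)..τ, k s * y s ≤ ∫ s in (n * δ)..τ, k s * y τ := by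
              refine intervalIntegral.integral_mono_on hτ.1 (iky _ _ hn0 hτ.1 hτT)
                ((iik _ _ hn0 hτ.1 hτT).mul_const _) fun s hs => ?_
              exact mul_le_mul_of_nonneg_left (hmax ⟨hs.1, hs.2.trans hτ.2⟩) (hk0 s)
          _ = (∫ s in (n * δ)..τ, k s) * y τ := by
              rw [intervalIntegral.integral_mul_const]
          _ ≤ 1 / 2 * y τ := by
              refine mul_le_mul_of_nonneg_right (small _ _ hn0 hτ.1 hτT ?_) (not_le.1 hneg).le
              push_cast at htn
              linarith [hτ.2]
      have h1 := H τ ⟨hn0.trans hτ.1, hτT⟩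
      rw [← intervalIntegral.integral_add_adjacent_intervals (iky 0 _ le_rfl hn0 hnT)
        (iky _ τ hn0 hτ.1 hτT)] at h1
      have h2 : y t ≤ y τ := hmax ⟨hle, le_rfl⟩
      have h3 : 0 ≤ C * a := by positivity
      nlinarith
  obtain ⟨n, hn⟩ := exists_nat_ge (T / δ)
  obtain ⟨C, hC, H⟩ := step n
  refine ⟨C, hC, fun y a hy ha hH t ht => H y a hy ha hH t ht ?_⟩
  rw [div_le_iff₀ hδ] at hn
  exact ht.2.trans hn

/-- If the primitive of `a` is small, then so is the integral of `a` against the primitive of any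
integrable `d`: integrate by parts. -/
theorem abs_integral_mul_primitive_le {a d : ℝ → ℝ} {t ε : ℝ} (ht : 0 ≤ t)
    (ha : IntervalIntegrable a volume 0 t) (hd : IntervalIntegrable d volume 0 t)
    (hε : ∀ s ∈ Icc 0 t, |∫ r in (0 : ℝ)..s, a r| ≤ ε) :
    |∫ s in (0 : ℝ)..t, a s * ∫ r in (0 : ℝ)..s, d r| ≤ 2 * ε * ∫ s in (0 : ℝ)..t, |d s| := by
  have hε0 : 0 ≤ ε := (abs_nonneg _).trans (hε t ⟨ht, le_rfl⟩)
  have acA := ha.absolutelyContinuousOnInterval_intervalIntegral (c := 0) (by simp)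
  have acD := hd.absolutelyContinuousOnInterval_intervalIntegral (c := 0) (by simp)
  have ibp := acD.integral_mul_deriv_eq_deriv_mul acA
  have dA := ha.ae_hasDerivAt_integral
  have dD := hd.ae_hasDerivAt_integral
  have e1 : ∫ s in (0 : ℝ)..t, (∫ r in (0 : ℝ)..s, d r) * deriv (fun x => ∫ r in (0 : ℝ)..x, a r) s
      = ∫ s in (0 : ℝ)..t, a s * ∫ r in (0 : ℝ)..s, d r := by
    refine intervalIntegral.integral_congr_ae ?_
    filter_upwards [dA] with s hs hst
    rw [(hs (uIoc_subset_uIcc hst) 0 left_mem_uIcc).deriv, mul_comm]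
  have e2 : ∫ s in (0 : ℝ)..t, deriv (fun x => ∫ r in (0 : ℝ)..x, d r) s * (∫ r in (0 : ℝ)..s, a r)
      = ∫ s in (0 : ℝ)..t, d s * ∫ r in (0 : ℝ)..s, a r := by
    refine intervalIntegral.integral_congr_ae ?_
    filter_upwards [dD] with s hs hst
    rw [(hs (uIoc_subset_uIcc hst) 0 (by simp)).deriv]
  rw [e1, e2] at ibp
  rw [ibp, intervalIntegral.integral_same, zero_mul, sub_zero]
  have b1 : |∫ r in (0 : ℝ)..t, d r| ≤ ∫ s in (0 : ℝ)..t, |d s| :=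
    intervalIntegral.abs_integral_le_integral_abs ht
  have b2 : |∫ s in (0 : ℝ)..t, d s * ∫ r in (0 : ℝ)..s, a r| ≤ ε * ∫ s in (0 : ℝ)..t, |d s| := by
    rw [← intervalIntegral.integral_const_mul]
    have := intervalIntegral.norm_integral_le_of_norm_le (μ := volume)
      (f := fun s => d s * ∫ r in (0 : ℝ)..s, a r) (g := fun s => ε * |d s|) ht
      (Eventually.of_forall fun s hs => ?_) (hd.abs.const_mul ε)
    · exact this
    rw [norm_mul, mul_comm]
    exact mul_le_mul_of_nonneg_right (hε s ⟨hs.1.le, hs.2⟩) (norm_nonneg _)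
  refine (abs_sub _ _).trans ?_
  rw [abs_mul]
  have := mul_le_mul b1 (hε t ⟨ht, le_rfl⟩) (abs_nonneg _) ((abs_nonneg _).trans b1)
  linarith

/-- A bounded weakly null sequence `ψₙ` tends to zero uniformly as a sequence of functionals on a
compact set: a finite net reduces to finitely many vectors. -/
theorem eventually_forall_abs_inner_le {E : Type*} [NormedAddCommGroup E] [InnerProductSpace ℝ E]
    {K : Set E} (hK : IsCompact K) {ψ : ℕ → E} {R : ℝ} (hR : ∀ n, ‖ψ n‖ ≤ R)
    (hψ : ∀ e : E, Tendsto (fun n => inner ℝ e (ψ n)) atTop (𝓝 0)) {ε : ℝ} (hε : 0 < ε) :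
    ∀ᶠ n in atTop, ∀ e ∈ K, |inner ℝ e (ψ n)| ≤ ε := by
  have hR0 : 0 ≤ R := (norm_nonneg _).trans (hR 0)
  obtain ⟨s, -, hsf, hs⟩ := hK.finite_cover_balls (e := ε / (2 * (R + 1))) (by positivity)
  have ev : ∀ᶠ n in atTop, ∀ c ∈ s, |inner ℝ c (ψ n)| < ε / 2 := by
    rw [eventually_all_finite hsf]
    intro c _
    have := (hψ c).abs
    rw [abs_zero] at this
    exact this.eventually_lt_const (by positivity)
  filter_upwards [ev] with n hn e he
  obtain ⟨c, hc, hec⟩ := mem_iUnion₂.1 (hs he)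
  rw [Metric.mem_ball, dist_eq_norm] at hec
  have h1 : inner ℝ e (ψ n) = inner ℝ c (ψ n) + inner ℝ (e - c) (ψ n) := by
    rw [inner_sub_left]; ring
  have h2 : |inner ℝ (e - c) (ψ n)| ≤ ε / 2 := by
    refine (abs_real_inner_le_norm _ _).trans ?_
    calc ‖e - c‖ * ‖ψ n‖ ≤ ε / (2 * (R + 1)) * (R + 1) :=
          mul_le_mul hec.le ((hR n).trans (by linarith)) (norm_nonneg _) (by positivity)
      _ = ε / 2 := by field_simp
  rw [h1]
  exact (abs_add_le _ _).trans (by linarith [hn c hc])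

/-! ### Pairings over `[0,t] × Z` -/

section WeakLimit

variable {Z : Type*} [MeasurableSpace Z]

theorem nuT_restrict {T t : ℝ} (ht : t ≤ T) (ν : Measure Z) [SFinite ν] :
    (nuT T ν).restrict (Iic t ×ˢ univ) = nuT t ν := by
  have h := Measure.prod_restrict (μ := volume.restrict (Icc 0 T)) (ν := ν) (Iic t) univ
  rw [Measure.restrict_univ] at h
  rw [nuT, ← h, Measure.restrict_restrict measurableSet_Iic, nuT]
  congr 2
  ext s
  simp only [mem_inter_iff, mem_Iic, mem_Icc]
  constructor
  · exact fun h => ⟨h.2.1, h.1⟩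
  · exact fun h => ⟨h.2, h.1, h.2.trans ht⟩

theorem nuT_le {T t : ℝ} (ht : t ≤ T) (ν : Measure Z) [SFinite ν] : nuT t ν ≤ nuT T ν :=
  nuT_restrict ht ν ▸ Measure.restrict_le_self

instance {T : ℝ} (ν : Measure Z) [SFinite ν] : SFinite (nuT T ν) := by
  unfold nuT; infer_instance

theorem integral_nuT {E : Type*} [NormedAddCommGroup E] [NormedSpace ℝ E] {t : ℝ} (ht : 0 ≤ t)
    (ν : Measure Z) [SFinite ν] {F : ℝ × Z → E} (hF : Integrable F (nuT t ν)) :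
    ∫ p, F p ∂nuT t ν = ∫ s in (0 : ℝ)..t, ∫ z, F (s, z) ∂ν := by
  rw [nuT, integral_prod _ hF, intervalIntegral.integral_of_le ht, integral_Icc_eq_integral_Ioc]

/-- For a set `A` of finite measure, the indicators of the truncations `A ∩ {(s, z) | s ≤ t}` vary
continuously with `t` in `L²`. -/
theorem continuous_indicatorConstLp_truncation {T : ℝ} (ν : Measure Z) [SFinite ν]
    {A : Set (ℝ × Z)} (hA : MeasurableSet A) (hAf : nuT T ν A < ∞) :
    Continuous fun t : ℝ => indicatorConstLp (E := ℝ) 2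
      (hA.inter (measurableSet_Iic.prod MeasurableSet.univ : MeasurableSet (Iic t ×ˢ (univ : Set Z))))
      (measure_inter_lt_top_of_left_ne_top (μ := nuT T ν) hAf.ne).ne 1 := by
  rw [continuous_iff_continuousAt]
  intro t
  refine tendsto_indicatorConstLp_set (by simp) ?_
  -- `ρ` is the time marginal of the part of `ν_T` carried by `A`
  set ρ : Measure ℝ := ((nuT T ν).restrict A).map Prod.fst with hρ
  have hρf : IsFiniteMeasure ρ := by
    constructor
    rw [hρ, Measure.map_apply measurable_fst MeasurableSet.univ]
    simpa using hAf
  have hρ0 : NullSingletonClass ρ := by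
    constructor
    intro a
    rw [hρ, Measure.map_apply measurable_fst (measurableSet_singleton a)]
    refine le_antisymm ((Measure.restrict_apply_le _ _).trans ?_) zero_le
    have : (Prod.fst ⁻¹' {a} : Set (ℝ × Z)) = {a} ×ˢ univ := by ext; simp
    rw [this, nuT, Measure.prod_prod]
    simp
  have hc := (intervalIntegral.continuous_primitive (μ := ρ) (f := fun _ => (1 : ℝ))
    (fun a b => intervalIntegrable_const) t).tendsto t
  have hc2 := (ENNReal.continuous_ofReal.tendsto _).comp hc.abs
  simp only [intervalIntegral.integral_same, abs_zero, ENNReal.ofReal_zero] at hc2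
  refine tendsto_of_tendsto_of_tendsto_of_le_of_le tendsto_const_nhds hc2 (fun _ => zero_le) ?_
  intro s
  have h1 : symmDiff (A ∩ Iic s ×ˢ univ) (A ∩ Iic t ×ˢ univ) ⊆ Prod.fst ⁻¹' (uIoc t s) ∩ A := by
    rintro ⟨r, z⟩ h
    simp only [mem_symmDiff, mem_inter_iff, mem_prod, mem_Iic, mem_univ, and_true, mem_preimage,
      mem_uIoc] at h ⊢
    grind
  calc nuT T ν (symmDiff (A ∩ Iic s ×ˢ univ) (A ∩ Iic t ×ˢ univ))
      ≤ nuT T ν (Prod.fst ⁻¹' (uIoc t s) ∩ A) := measure_mono h1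
    _ = ρ (uIoc t s) := by
        rw [hρ, Measure.map_apply measurable_fst measurableSet_uIoc,
          Measure.restrict_apply (measurable_fst measurableSet_uIoc)]
    _ = ENNReal.ofReal |∫ _ in t..s, (1 : ℝ) ∂ρ| := by
        rw [intervalIntegral.abs_integral_eq_abs_integral_uIoc, setIntegral_const, smul_eq_mul,
          mul_one, abs_of_nonneg measureReal_nonneg, ofReal_measureReal]

/-- If `ψₙ ⇀ 0` weakly in `L²(ν_T)`, then `∫_{A ∩ ([0,t] × Z)} ψₙ dν_T → 0` uniformly in `t`. -/
theorem eventually_forall_abs_setIntegral_le {T : ℝ} (ν : Measure Z) [SFinite ν]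
    {ψ : ℕ → Lp ℝ 2 (nuT T ν)} {R : ℝ} (hR : ∀ n, ‖ψ n‖ ≤ R)
    (hψ : ∀ e : Lp ℝ 2 (nuT T ν), Tendsto (fun n => inner ℝ e (ψ n)) atTop (𝓝 0))
    {A : Set (ℝ × Z)} (hA : MeasurableSet A) (hAf : nuT T ν A < ∞) {ε : ℝ} (hε : 0 < ε) :
    ∀ᶠ n in atTop, ∀ t ∈ Icc 0 T, |∫ p, A.indicator (ψ n) p ∂nuT t ν| ≤ ε := by
  have hK := (isCompact_Icc (a := (0 : ℝ)) (b := T)).image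
    (continuous_indicatorConstLp_truncation ν hA hAf)
  filter_upwards [eventually_forall_abs_inner_le hK hR hψ hε] with n hn t ht
  have := hn _ (mem_image_of_mem _ ht)
  rw [L2.inner_indicatorConstLp_one] at this
  rw [← nuT_restrict ht.2, integral_indicator hA, Measure.restrict_restrict hA]
  exact this

variable {H : Type*} [NormedAddCommGroup H] [InnerProductSpace ℝ H]

theorem memLp_mul_inner {T : ℝ} (ν : Measure Z) [SFinite ν] {ψ : ℝ × Z → ℝ} {g : ℝ × Z → H}
    {X : ℝ → H} {M : ℝ} (hψ : MemLp ψ 2 (nuT T ν)) (hg : MemLp g 2 (nuT T ν))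
    (hX : ContinuousOn X (Icc 0 T)) (hM : ∀ t ∈ Icc 0 T, ‖X t‖ ≤ M) :
    Integrable (fun p => ψ p * inner ℝ (g p) (X p.1)) (nuT T ν) ∧
    ∫ p, ‖ψ p * inner ℝ (g p) (X p.1)‖ ∂nuT T ν ≤
      M * ((eLpNorm ψ 2 (nuT T ν)).toReal * (eLpNorm g 2 (nuT T ν)).toReal) := by
  have hXm : AEStronglyMeasurable (fun p : ℝ × Z => X p.1) (nuT T ν) :=
    (hX.aestronglyMeasurable measurableSet_Icc).comp_fst
  have hb : ∀ᵐ p ∂nuT T ν, ‖X p.1‖ ≤ M :=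
    Measure.quasiMeasurePreserving_fst.ae
      ((ae_restrict_mem measurableSet_Icc).mono fun t ht => hM t ht)
  have hprod : Integrable (fun p => ‖ψ p‖ * ‖g p‖) (nuT T ν) :=
    MemLp.integrable_mul hψ.norm hg.norm
  have hle : ∀ᵐ p ∂nuT T ν, ‖ψ p * inner ℝ (g p) (X p.1)‖ ≤ M * (‖ψ p‖ * ‖g p‖) := by
    filter_upwards [hb] with p hp
    rw [norm_mul]
    calc ‖ψ p‖ * ‖inner ℝ (g p) (X p.1)‖ ≤ ‖ψ p‖ * (‖g p‖ * M) := by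
          refine mul_le_mul_of_nonneg_left ((norm_inner_le_norm _ _).trans ?_) (norm_nonneg _)
          exact mul_le_mul_of_nonneg_left hp (norm_nonneg _)
      _ = _ := by ring
  have hint : Integrable (fun p => ψ p * inner ℝ (g p) (X p.1)) (nuT T ν) :=
    (hprod.const_mul M).mono' (hψ.1.mul (hg.1.inner hXm)) hle
  refine ⟨hint, (integral_mono_ae hint.norm (hprod.const_mul M) hle).trans ?_⟩
  rw [integral_const_mul]
  by_cases hμ : nuT T ν = 0
  · simp [hμ]
  have hM0 : 0 ≤ M := by
    have : NeZero (nuT T ν) := ⟨hμ⟩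
    obtain ⟨p, hp⟩ := hb.exists
    exact (norm_nonneg _).trans hp
  refine mul_le_mul_of_nonneg_left ?_ hM0
  have h2 := lintegral_enorm_mul_enorm_le hψ.1 hg.1
  have h3 := ENNReal.toReal_mono (ENNReal.mul_ne_top hψ.2.ne hg.2.ne) h2
  rw [ENNReal.toReal_mul] at h3
  refine le_trans (le_of_eq ?_) h3
  rw [integral_eq_lintegral_of_nonneg_ae (Eventually.of_forall fun p => by positivity) hprod.1]
  congr 1
  refine lintegral_congr fun p => ?_
  rw [ENNReal.ofReal_mul (norm_nonneg _), ofReal_norm, ofReal_norm]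

theorem abs_integral_mul_inner_le {T t : ℝ} (ht : t ≤ T) (ν : Measure Z) [SFinite ν]
    {ψ : ℝ × Z → ℝ} {g : ℝ × Z → H}
    {X : ℝ → H} {M : ℝ} (hψ : MemLp ψ 2 (nuT T ν)) (hg : MemLp g 2 (nuT T ν))
    (hX : ContinuousOn X (Icc 0 T)) (hM : ∀ t ∈ Icc 0 T, ‖X t‖ ≤ M) :
    |∫ p, ψ p * inner ℝ (g p) (X p.1) ∂nuT t ν| ≤
      M * ((eLpNorm ψ 2 (nuT T ν)).toReal * (eLpNorm g 2 (nuT T ν)).toReal) := by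
  obtain ⟨h1, h2⟩ := memLp_mul_inner ν hψ hg hX hM
  refine (abs_integral_le_integral_abs).trans (le_trans ?_ h2)
  exact integral_mono_measure (nuT_le ht ν) (Eventually.of_forall fun _ => abs_nonneg _) h1.norm

end WeakLimit

/-! ### Pairing a weakly null sequence with bounded paths -/

section WeakLimit

variable {Z : Type*} [MeasurableSpace Z]
variable {H : Type*} [NormedAddCommGroup H] [InnerProductSpace ℝ H]

/-- For `g = 1_A v` the pairing is `∫₀ᵗ a(s) ⟪v, X s⟫ ds` with `a(s) = ∫_Z 1_A ψ dν`, and the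
primitive of `a` tends to zero uniformly. -/
theorem eventually_forall_abs_integral_indicator_le {T : ℝ} (ν : Measure Z) [SFinite ν]
    {ψ : ℕ → Lp ℝ 2 (nuT T ν)} {R : ℝ} (hR : ∀ n, ‖ψ n‖ ≤ R)
    (hψ : ∀ e : Lp ℝ 2 (nuT T ν), Tendsto (fun n => inner ℝ e (ψ n)) atTop (𝓝 0))
    {X : ℕ → ℝ → H} {v : H} {K : ℝ}
    (hv : ∀ n, ∃ d : ℝ → ℝ, IntegrableOn d (Icc 0 T) ∧ ∫ s in (0 : ℝ)..T, |d s| ≤ K ∧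
      ∀ t ∈ Icc 0 T, inner ℝ v (X n t) = ∫ s in (0 : ℝ)..t, d s)
    {A : Set (ℝ × Z)} (hA : MeasurableSet A) (hAf : nuT T ν A < ∞)
    (hint : ∀ n, Integrable (fun p => ψ n p * inner ℝ (A.indicator (fun _ => v) p) (X n p.1))
      (nuT T ν)) {ε : ℝ} (hε : 0 < ε) :
    ∀ᶠ n in atTop, ∀ t ∈ Icc 0 T,
      |∫ p, ψ n p * inner ℝ (A.indicator (fun _ => v) p) (X n p.1) ∂nuT t ν| ≤ ε := by
  have hη : 0 < ε / (2 * (|K| + 1)) := by positivity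
  filter_upwards [eventually_forall_abs_setIntegral_le ν hR hψ hA hAf hη] with n hn t ht
  obtain ⟨d, hd, hdK, hdX⟩ := hv n
  have hT : 0 ≤ T := ht.1.trans ht.2
  have hψA : Integrable (A.indicator (ψ n)) (nuT T ν) := by
    have : IsFiniteMeasure ((nuT T ν).restrict A) :=
      ⟨by rw [Measure.restrict_apply_univ]; exact hAf⟩
    exact (integrable_indicator_iff hA).2
      (((Lp.memLp (ψ n)).restrict A).integrable (by norm_num))
  set a : ℝ → ℝ := fun s => ∫ z, A.indicator (ψ n) (s, z) ∂ν with ha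
  have ia : IntegrableOn a (Icc 0 T) := hψA.integral_prod_left
  have e : ∫ p, ψ n p * inner ℝ (A.indicator (fun _ => v) p) (X n p.1) ∂nuT t ν =
      ∫ s in (0 : ℝ)..t, a s * ∫ r in (0 : ℝ)..s, d r := by
    rw [integral_nuT ht.1 ν ((hint n).mono_measure (nuT_le ht.2 ν))]
    refine intervalIntegral.integral_congr fun s hs => ?_
    rw [uIcc_of_le ht.1] at hs
    simp only
    rw [← hdX s ⟨hs.1, hs.2.trans ht.2⟩, ha, ← integral_mul_const]
    refine integral_congr_ae (Eventually.of_forall fun z => ?_)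
    by_cases hz : (s, z) ∈ A <;> simp [hz]
  rw [e]
  have ii : ∀ {f : ℝ → ℝ}, IntegrableOn f (Icc 0 T) → ∀ {c d}, 0 ≤ c → c ≤ d → d ≤ T →
      IntervalIntegrable f volume c d := by
    intro f hf c d hc hcd hd
    refine IntegrableOn.intervalIntegrable ?_
    rw [uIcc_of_le hcd]
    exact hf.mono_set (Icc_subset_Icc hc hd)
  refine (abs_integral_mul_primitive_le ht.1 (ii ia le_rfl ht.1 ht.2) (ii hd le_rfl ht.1 ht.2)
    (ε := ε / (2 * (|K| + 1))) fun s hs => ?_).trans ?_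
  · have hsT : s ∈ Icc 0 T := ⟨hs.1, hs.2.trans ht.2⟩
    have := hn s hsT
    rwa [integral_nuT hs.1 ν (hψA.mono_measure (nuT_le hsT.2 ν))] at this
  · have h1 := intervalIntegral.integral_add_adjacent_intervals
      (ii hd le_rfl ht.1 ht.2).abs (ii hd ht.1 ht.2 le_rfl).abs
    have h2 : 0 ≤ ∫ s in t..T, |d s| :=
      intervalIntegral.integral_nonneg ht.2 fun _ _ => abs_nonneg _
    have h3 : ∫ s in (0 : ℝ)..t, |d s| ≤ |K| + 1 := by linarith [le_abs_self K]
    calc 2 * (ε / (2 * (|K| + 1))) * ∫ s in (0 : ℝ)..t, |d s|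
        ≤ 2 * (ε / (2 * (|K| + 1))) * (|K| + 1) :=
          mul_le_mul_of_nonneg_left h3 (by positivity)
      _ = ε := by field_simp

theorem exists_mem_eLpNorm_indicator_sub_le {α E : Type*} [MeasurableSpace α] {μ : Measure α}
    [NormedAddCommGroup E] {D : Set E} (hD : Dense D) (c : E) {s : Set α} (hs : MeasurableSet s) (hμs : μ s < ∞)
    {ε : ℝ≥0∞} (hε : ε ≠ 0) :
    ∃ v ∈ D, eLpNorm ((s.indicator fun _ => v) - s.indicator fun _ => c) 2 μ ≤ ε := by
  have hlim : Tendsto (fun v : E => ‖v - c‖ₑ * μ s ^ (1 / (2 : ℝ))) (𝓝 c) (𝓝 0) := by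
    have h1 : Tendsto (fun v : E => ‖v - c‖ₑ) (𝓝 c) (𝓝 0) := by
      have : Continuous fun v : E => ‖v - c‖ₑ := by fun_prop
      simpa using this.tendsto c
    have := ENNReal.Tendsto.mul_const (b := μ s ^ (1 / (2 : ℝ))) h1
      (Or.inr (ENNReal.rpow_ne_top_of_nonneg (by norm_num) hμs.ne))
    simpa using this
  have ev := hlim.eventually_le_const (u := ε) (pos_iff_ne_zero.2 hε)
  obtain ⟨v, hv, hvD⟩ := (mem_closure_iff_frequently.1 (hD c)).and_eventually ev |>.exists
  refine ⟨v, hv, ?_⟩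
  have : ((s.indicator fun _ => v) - s.indicator fun _ => c) = s.indicator fun _ => v - c := by
    ext a
    by_cases ha : a ∈ s <;> simp [ha]
  rw [this, eLpNorm_indicator_const hs (by norm_num) (by norm_num)]
  simpa using hvD

/-- If `ψₙ ⇀ 0` weakly in `L²(ν_T)` and the paths `Xₙ` are bounded, with
derivatives of `⟪v, Xₙ⟫` bounded in `L¹(0,T)` for each `v` in a dense set, then
`∫_{[0,t] × Z} ψₙ ⟪g, Xₙ⟫ dν_T → 0` uniformly in `t`, for every `g ∈ L²(ν_T; H)`. The functions
`g = 1_A v` span a dense subspace, and the estimate is stable under `L²`-limits of `g`. -/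
theorem eventually_forall_abs_integral_mul_inner_le {T : ℝ} (ν : Measure Z) [SFinite ν]
    {ψ : ℕ → Lp ℝ 2 (nuT T ν)} {R : ℝ} (hR : ∀ n, ‖ψ n‖ ≤ R)
    (hψ : ∀ e : Lp ℝ 2 (nuT T ν), Tendsto (fun n => inner ℝ e (ψ n)) atTop (𝓝 0))
    {X : ℕ → ℝ → H} (hX : ∀ n, ContinuousOn (X n) (Icc 0 T)) {M : ℝ}
    (hM : ∀ n, ∀ t ∈ Icc 0 T, ‖X n t‖ ≤ M) {D : Set H} (hD : Dense D)
    (hv : ∀ v ∈ D, ∃ K, ∀ n, ∃ d : ℝ → ℝ, IntegrableOn d (Icc 0 T) ∧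
      ∫ s in (0 : ℝ)..T, |d s| ≤ K ∧
      ∀ t ∈ Icc 0 T, inner ℝ v (X n t) = ∫ s in (0 : ℝ)..t, d s)
    {g : ℝ × Z → H} (hg : MemLp g 2 (nuT T ν)) {ε : ℝ} (hε : 0 < ε) :
    ∀ᶠ n in atTop, ∀ t ∈ Icc 0 T, |∫ p, ψ n p * inner ℝ (g p) (X n p.1) ∂nuT t ν| ≤ ε := by
  by_cases hT : 0 ≤ T
  swap
  · refine Eventually.of_forall fun n t ht => absurd (ht.1.trans ht.2) hT
  have hM0 : 0 ≤ M := (norm_nonneg _).trans (hM 0 0 ⟨le_rfl, hT⟩)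
  have hR0 : 0 ≤ R := (norm_nonneg _).trans (hR 0)
  have hψR : ∀ n, (eLpNorm (ψ n) 2 (nuT T ν)).toReal ≤ R := fun n => hR n
  let Pr : (ℝ × Z → H) → Prop := fun g => MemLp g 2 (nuT T ν) ∧ ∀ ε : ℝ, 0 < ε →
    ∀ᶠ n in atTop, ∀ t ∈ Icc 0 T, |∫ p, ψ n p * inner ℝ (g p) (X n p.1) ∂nuT t ν| ≤ ε
  have hadd : ∀ n {g₁ g₂ : ℝ × Z → H}, MemLp g₁ 2 (nuT T ν) → MemLp g₂ 2 (nuT T ν) →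
      ∀ t ∈ Icc 0 T, ∫ p, ψ n p * inner ℝ ((g₁ + g₂) p) (X n p.1) ∂nuT t ν =
        (∫ p, ψ n p * inner ℝ (g₁ p) (X n p.1) ∂nuT t ν) +
        ∫ p, ψ n p * inner ℝ (g₂ p) (X n p.1) ∂nuT t ν := by
    intro n g₁ g₂ h₁ h₂ t ht
    rw [← integral_add
      ((memLp_mul_inner ν (Lp.memLp (ψ n)) h₁ (hX n) (hM n)).1.mono_measure (nuT_le ht.2 ν))
      ((memLp_mul_inner ν (Lp.memLp (ψ n)) h₂ (hX n) (hM n)).1.mono_measure (nuT_le ht.2 ν))]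
    refine integral_congr_ae (Eventually.of_forall fun p => ?_)
    simp only [Pi.add_apply, inner_add_left]
    ring
  have hη : 0 < ε / (2 * (M * R + 1)) := by positivity
  obtain ⟨g', hgg', hg', hlim⟩ := hg.induction_dense (by norm_num) Pr
    (by
      intro c s hs hμs δ hδ
      obtain ⟨v, hvD, hvc⟩ := exists_mem_eLpNorm_indicator_sub_le hD c hs hμs hδ
      have hmem : MemLp (s.indicator fun _ => v) 2 (nuT T ν) :=
        memLp_indicator_const 2 hs v (Or.inr hμs.ne)
      obtain ⟨K, hK⟩ := hv v hvD
      exact ⟨s.indicator fun _ => v, hvc, hmem, fun ε hε =>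
        eventually_forall_abs_integral_indicator_le ν hR hψ hK hs hμs
          (fun n => (memLp_mul_inner ν (Lp.memLp (ψ n)) hmem (hX n) (hM n)).1) hε⟩)
    (by
      rintro g₁ g₂ ⟨h₁, h₁'⟩ ⟨h₂, h₂'⟩
      refine ⟨h₁.add h₂, fun ε hε => ?_⟩
      filter_upwards [h₁' (ε / 2) (by positivity), h₂' (ε / 2) (by positivity)] with n e₁ e₂ t ht
      rw [hadd n h₁ h₂ t ht]
      exact (abs_add_le _ _).trans (by linarith [e₁ t ht, e₂ t ht]))
    (fun g hg => hg.1.1) (ε := ENNReal.ofReal (ε / (2 * (M * R + 1))))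
    (by simpa using hη)
  filter_upwards [hlim (ε / 2) (by positivity)] with n hn t ht
  have hsub : MemLp (g - g') 2 (nuT T ν) := hg.sub hg'
  have e : g = g' + (g - g') := by abel
  rw [e, hadd n hg' hsub t ht]
  have b := abs_integral_mul_inner_le ht.2 ν (Lp.memLp (ψ n)) hsub (hX n) (hM n)
  have b2 : (eLpNorm (g - g') 2 (nuT T ν)).toReal ≤ ε / (2 * (M * R + 1)) :=
    ENNReal.toReal_le_of_le_ofReal hη.le hgg'
  have b3 : M * ((eLpNorm (ψ n) 2 (nuT T ν)).toReal * (eLpNorm (g - g') 2 (nuT T ν)).toReal)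
      ≤ ε / 2 := by
    calc _ ≤ M * (R * (ε / (2 * (M * R + 1)))) := by
          refine mul_le_mul_of_nonneg_left ?_ hM0
          exact mul_le_mul (hψR n) b2 ENNReal.toReal_nonneg hR0
      _ = (M * R) / (M * R + 1) * (ε / 2) := by field_simp
      _ ≤ 1 * (ε / 2) := by
          refine mul_le_mul_of_nonneg_right ?_ (by positivity)
          rw [div_le_one (by positivity)]
          linarith
      _ = ε / 2 := one_mul _
  exact (abs_add_le _ _).trans (by linarith [hn t ht])

end WeakLimit

/-! ### The forcing term and the coefficients -/

section Forcing

variable {Z : Type*} [MeasurableSpace Z]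
variable {H : Type*} [NormedAddCommGroup H] [InnerProductSpace ℝ H]

/-- The forcing term `s ↦ ∫_Z ψ(s,z) g(s,z) ν(dz)` of the skeleton equation. -/
def forcing (ν : Measure Z) (g : ℝ × Z → H) (ψ : ℝ × Z → ℝ) (s : ℝ) : H :=
  ∫ z, ψ (s, z) • g (s, z) ∂ν

variable {T : ℝ} (ν : Measure Z) {g : ℝ × Z → H} {ψ : ℝ × Z → ℝ}

theorem integrable_smul_of_memLp_two (hψ : MemLp ψ 2 (nuT T ν)) (hg : MemLp g 2 (nuT T ν)) :
    Integrable (fun p => ψ p • g p) (nuT T ν) :=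
  memLp_one_iff_integrable.1 (hg.smul (r := 1) hψ)

variable [SFinite ν]

theorem integrableOn_forcing (hψ : MemLp ψ 2 (nuT T ν)) (hg : MemLp g 2 (nuT T ν)) :
    IntegrableOn (forcing ν g ψ) (Icc 0 T) :=
  (integrable_smul_of_memLp_two ν hψ hg).integral_prod_left

theorem integral_norm_forcing_le (hT : 0 ≤ T) (hψ : MemLp ψ 2 (nuT T ν))
    (hg : MemLp g 2 (nuT T ν)) :
    ∫ s in (0 : ℝ)..T, ‖forcing ν g ψ s‖ ≤
      (eLpNorm ψ 2 (nuT T ν)).toReal * (eLpNorm g 2 (nuT T ν)).toReal := by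
  have hi := integrable_smul_of_memLp_two ν hψ hg
  have h1 : ∫ s in (0 : ℝ)..T, ‖forcing ν g ψ s‖ ≤ ∫ p, ‖ψ p • g p‖ ∂nuT T ν := by
    rw [integral_nuT hT ν hi.norm]
    refine intervalIntegral.integral_mono_on hT ?_ ?_ fun s _ => norm_integral_le_integral_norm _
    · exact IntegrableOn.intervalIntegrable
        (by rw [uIcc_of_le hT]; exact (integrableOn_forcing ν hψ hg).norm)
    · exact IntegrableOn.intervalIntegrable
        (by rw [uIcc_of_le hT]; exact hi.norm.integral_prod_left)
  refine h1.trans ?_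
  have h2 := lintegral_enorm_mul_enorm_le hψ.1 hg.1
  have h3 := ENNReal.toReal_mono (ENNReal.mul_ne_top hψ.2.ne hg.2.ne) h2
  rw [ENNReal.toReal_mul] at h3
  refine le_trans (le_of_eq ?_) h3
  rw [integral_norm_eq_lintegral_enorm hi.1]
  simp only [enorm_smul]

theorem integral_inner_forcing [CompleteSpace H] (hψ : MemLp ψ 2 (nuT T ν))
    (hg : MemLp g 2 (nuT T ν))
    {X : ℝ → H} (hX : ContinuousOn X (Icc 0 T)) {t : ℝ} (ht : t ∈ Icc 0 T) :
    ∫ s in (0 : ℝ)..t, inner ℝ (forcing ν g ψ s) (X s) =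
      ∫ p, ψ p * inner ℝ (g p) (X p.1) ∂nuT t ν := by
  obtain ⟨M, hM⟩ := isCompact_Icc.exists_bound_of_continuousOn hX
  rw [integral_nuT ht.1 ν ((memLp_mul_inner ν hψ hg hX hM).1.mono_measure (nuT_le ht.2 ν))]
  have hi := (integrable_smul_of_memLp_two ν hψ hg).prod_right_ae
  rw [ae_restrict_iff' measurableSet_Icc] at hi
  refine intervalIntegral.integral_congr_ae ?_
  filter_upwards [hi] with s hs hst
  rw [uIoc_of_le ht.1] at hst
  have hs := hs ⟨hst.1.le, hst.2.trans ht.2⟩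
  rw [forcing, real_inner_comm, ← integral_inner hs]
  refine integral_congr_ae (Eventually.of_forall fun z => ?_)
  simp only [inner_smul_right]
  rw [real_inner_comm]

theorem forcing_sub_ae (hg : MemLp g 2 (nuT T ν)) (φ₁ φ₂ : Lp ℝ 2 (nuT T ν)) :
    ∀ᵐ s ∂volume.restrict (Icc 0 T),
      forcing ν g (φ₁ - φ₂ : Lp ℝ 2 (nuT T ν)) s = forcing ν g φ₁ s - forcing ν g φ₂ s := by
  have h1 := (integrable_smul_of_memLp_two ν (Lp.memLp φ₁) hg).prod_right_ae
  have h2 := (integrable_smul_of_memLp_two ν (Lp.memLp φ₂) hg).prod_right_ae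
  have h3 := Measure.ae_ae_of_ae_prod (Lp.coeFn_sub φ₁ φ₂)
  filter_upwards [h1, h2, h3] with s e1 e2 e3
  rw [forcing, forcing, forcing, ← integral_sub e1 e2]
  refine integral_congr_ae ?_
  filter_upwards [e3] with z hz
  rw [hz, Pi.sub_apply, sub_smul]

end Forcing

namespace PosDefOperator

variable {H : Type*} [NormedAddCommGroup H] [InnerProductSpace ℝ H] [CompleteSpace H]
variable (P : PosDefOperator H)

/-- The inclusion `V ⊆ H` as a bounded operator. -/
def inclL : P.V →L[ℝ] H :=
  P.incl.mkContinuousOfExistsBound <| by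
    obtain ⟨c, hc⟩ := P.continuous_embedding
    exact ⟨c, fun x => by rw [norm_V]; exact hc x⟩

theorem inclL_apply (x : P.V) : P.inclL x = P.incl x := rfl

theorem dense_range_incl : Dense (range P.incl) := by
  have := P.isSqrt.selfAdjoint.dense_domain
  convert this
  ext y
  constructor
  · rintro ⟨x, rfl⟩; exact x.2
  · intro h; exact ⟨⟨y, h⟩, rfl⟩

theorem incl_toV {y : H} (hy : y ∈ P.sqrtA.domain) : P.incl (P.toV y) = y := by
  have h : P.toV y = (⟨y, hy⟩ : P.sqrtA.domain) := dif_pos hy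
  rw [h]; rfl

variable {P}

theorem MemCL2.incl_toV_ae {T : ℝ} {Y : ℝ → H} (hY : P.MemCL2 T Y) :
    ∀ᵐ t ∂volume.restrict (Icc 0 T), P.incl (P.toV (Y t)) = Y t :=
  hY.mem_V.mono fun _ ht => P.incl_toV ht

end PosDefOperator

section Coefficients

-- Mathlib's own setting; without it the operator norm on `V →L[ℝ] V →L[ℝ] V →L[ℝ] ℝ` is not found.
set_option maxSynthPendingDepth 3

namespace AssumptionB

variable {H : Type*} [NormedAddCommGroup H] [InnerProductSpace ℝ H] [CompleteSpace H]
  {P : PosDefOperator H} {Q : Type*} [NormedAddCommGroup Q] [NormedSpace ℝ Q]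
  {VtoQ : P.V →ₗ[ℝ] Q} {QtoH : Q →ₗ[ℝ] H} {B : P.V →L[ℝ] P.V →L[ℝ] (P.V →L[ℝ] ℝ)}

theorem apply_self_eq_zero (hB : AssumptionB P Q VtoQ QtoH B) (u v : P.V) : B u v v = 0 := by
  linarith [hB.skew u v v]

/-- Antisymmetry moves the `V`-norm onto the test vector, so that only `Q`-norms of `u` and `v`
remain; interpolation then bounds these. -/
theorem exists_estimates (hB : AssumptionB P Q VtoQ QtoH B) :
    ∃ C : ℝ, 0 ≤ C ∧ (∀ u v : P.V, |B u v u| ≤ C * (‖P.incl u‖ * ‖u‖ * ‖v‖)) ∧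
      ∀ u v : P.V, ‖B u v‖ ^ 2 ≤ C ^ 2 * (‖P.incl u‖ * ‖u‖ * (‖P.incl v‖ * ‖v‖)) := by
  obtain ⟨a, ha, hint⟩ := hB.interpolation
  obtain ⟨C, hC, hb⟩ := hB.bound
  refine ⟨C * a, by positivity, fun u v => ?_, fun u v => ?_⟩
  · calc |B u v u| ≤ C * ‖VtoQ u‖ * ‖v‖ * ‖VtoQ u‖ := hb u v u
      _ = C * ‖v‖ * ‖VtoQ u‖ ^ 2 := by ring
      _ ≤ C * ‖v‖ * (a * ‖P.incl u‖ * ‖u‖) :=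
          mul_le_mul_of_nonneg_left (hint u) (by positivity)
      _ = _ := by ring
  · have h1 : ‖B u v‖ ≤ C * ‖VtoQ u‖ * ‖VtoQ v‖ := by
      refine ContinuousLinearMap.opNorm_le_bound _ (by positivity) fun w => ?_
      rw [Real.norm_eq_abs, hB.skew, abs_neg]
      exact (hb u w v).trans (le_of_eq (by ring))
    calc ‖B u v‖ ^ 2 ≤ (C * ‖VtoQ u‖ * ‖VtoQ v‖) ^ 2 := by gcongr
      _ = C ^ 2 * (‖VtoQ u‖ ^ 2 * ‖VtoQ v‖ ^ 2) := by ring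
      _ ≤ C ^ 2 * ((a * ‖P.incl u‖ * ‖u‖) * (a * ‖P.incl v‖ * ‖v‖)) := by
          refine mul_le_mul_of_nonneg_left ?_ (by positivity)
          exact mul_le_mul (hint u) (hint v) (by positivity) (by positivity)
      _ = _ := by ring

/-- `B` maps two functions of `L^∞(0,T; H) ∩ L²(0,T; V)` to `L²(0,T; V')`. -/
theorem memLp_two (hB : AssumptionB P Q VtoQ QtoH B) {α : Type*} [MeasurableSpace α]
    {μ : Measure α} {x y : α → P.V} (hx : MemLp x 2 μ) (hy : MemLp y 2 μ) {M N : ℝ}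
    (hM : ∀ᵐ a ∂μ, ‖P.incl (x a)‖ ≤ M) (hN : ∀ᵐ a ∂μ, ‖P.incl (y a)‖ ≤ N) :
    MemLp (fun a => B (x a) (y a)) 2 μ := by
  obtain ⟨C, -, -, hC⟩ := hB.exists_estimates
  have hc : Continuous fun p : P.V × P.V => B p.1 p.2 := B.isBoundedBilinearMap.continuous
  have hm : AEStronglyMeasurable (fun a => B (x a) (y a)) μ :=
    hc.comp_aestronglyMeasurable (hx.1.prodMk hy.1)
  rw [memLp_two_iff_integrable_sq_norm hm]
  have hi : Integrable (fun a => ‖x a‖ * ‖y a‖) μ := MemLp.integrable_mul hx.norm hy.norm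
  refine (hi.const_mul (C ^ 2 * (M * N))).mono' (hm.norm.pow 2) ?_
  filter_upwards [hM, hN] with a h1 h2
  rw [Real.norm_of_nonneg (by positivity)]
  refine (hC _ _).trans ?_
  have h3 : ‖P.incl (x a)‖ * ‖P.incl (y a)‖ ≤ M * N :=
    mul_le_mul h1 h2 (norm_nonneg _) ((norm_nonneg _).trans h1)
  calc C ^ 2 * (‖P.incl (x a)‖ * ‖x a‖ * (‖P.incl (y a)‖ * ‖y a‖))
      = C ^ 2 * (‖x a‖ * ‖y a‖) * (‖P.incl (x a)‖ * ‖P.incl (y a)‖) := by ring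
    _ ≤ C ^ 2 * (‖x a‖ * ‖y a‖) * (M * N) := mul_le_mul_of_nonneg_left h3 (by positivity)
    _ = _ := by ring

end AssumptionB

end Coefficients

/-- `(t, z) ↦ G(t, u⁰(t), z)` lies in `L²(ν_T; H)`. -/
theorem AssumptionG.memLp_two {H : Type*} [NormedAddCommGroup H] [InnerProductSpace ℝ H]
    [CompleteSpace H] [TopologicalSpace.SeparableSpace H] [MeasurableSpace H] [BorelSpace H]
    {Z : Type*} [MeasurableSpace Z] {P : PosDefOperator H} {T : ℝ} (hT : 0 < T) {ν : Measure Z}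
    [SFinite ν] {G : ℝ → H → Z → H} (hG : AssumptionG P T ν G) {u₀ : ℝ → H}
    (hu : P.MemCL2 T u₀) :
    MemLp (fun p : ℝ × Z => G p.1 (u₀ p.1) p.2) 2 (nuT T ν) := by
  have : SecondCountableTopology H := UniformSpace.secondCountable_of_separable H
  obtain ⟨ρ, L₁, L₂, L₃, -, -, ⟨h2, hL2⟩, ⟨h3, hL3⟩, -, hb⟩ := hG.bounds
  obtain ⟨M, hM⟩ := isCompact_Icc.exists_bound_of_continuousOn hu.continuousOn
  have hmem : ∀ᵐ p ∂nuT T ν, p.1 ∈ Icc 0 T ∧ u₀ p.1 ∈ P.sqrtA.domain :=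
    Measure.quasiMeasurePreserving_fst.ae ((ae_restrict_mem measurableSet_Icc).and hu.mem_V)
  have hm : AEStronglyMeasurable (fun p : ℝ × Z => G p.1 (u₀ p.1) p.2) (nuT T ν) := by
    have hproj : Measurable fun p : ℝ × Z => projIcc 0 T hT.le p.1 :=
      continuous_projIcc.measurable.comp measurable_fst
    have hu0 : Measurable fun p : ℝ × Z => u₀ (projIcc 0 T hT.le p.1) :=
      (continuousOn_iff_continuous_domRestrict.1 hu.continuousOn).measurable.comp hproj
    have hmeas : Measurable fun p : ℝ × Z =>
        G (projIcc 0 T hT.le p.1) (u₀ (projIcc 0 T hT.le p.1)) p.2 :=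
      hG.measurable.comp (hproj.prodMk (hu0.prodMk measurable_snd))
    refine hmeas.stronglyMeasurable.aestronglyMeasurable.congr ?_
    filter_upwards [hmem] with p hp
    rw [projIcc_of_mem hT.le hp.1]
  refine (hL2.add (hL3.mul_const M)).mono' hm ?_
  filter_upwards [hmem] with p hp
  have h := hb p.1 hp.1 (P.toV (u₀ p.1)) p.2
  rw [P.incl_toV hp.2] at h
  refine h.trans ?_
  exact add_le_add le_rfl (mul_le_mul_of_nonneg_left (hM _ hp.1) (h3.1 _ hp.1 _))

/-! ### The skeleton equation: energy form and stability -/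

section Skeleton

set_option maxSynthPendingDepth 3

variable {H : Type*} [NormedAddCommGroup H] [InnerProductSpace ℝ H] [CompleteSpace H]
  {P : PosDefOperator H} {Q : Type*} [NormedAddCommGroup Q] [NormedSpace ℝ Q]
  {VtoQ : P.V →ₗ[ℝ] Q} {QtoH : Q →ₗ[ℝ] H} {B : P.V →L[ℝ] P.V →L[ℝ] (P.V →L[ℝ] ℝ)}
  {T : ℝ} {u₀ : ℝ → H}

/-- The linear part `-𝒜 x - B(x, u) - B(u, x)` of the skeleton equation, an element of `V'`. -/
def drift (P : PosDefOperator H) (B : P.V →L[ℝ] P.V →L[ℝ] (P.V →L[ℝ] ℝ)) (u x : P.V) :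
    P.V →L[ℝ] ℝ :=
  -P.opA x - B x u - B u x

theorem drift_sub (u x y : P.V) : drift P B u (x - y) = drift P B u x - drift P B u y := by
  simp only [drift, map_sub, sub_apply]
  abel

theorem norm_drift_le (u x : P.V) :
    ‖drift P B u x‖ ≤ 1 + ‖x‖ ^ 2 + 2 * ‖B‖ * (‖x‖ ^ 2 + ‖u‖ ^ 2) := by
  have h1 : ‖P.opA x‖ = ‖x‖ := innerSL_apply_norm ℝ x
  have h2 := B.le_opNorm₂ x u
  have h3 := B.le_opNorm₂ u x
  have h4 : ‖drift P B u x‖ ≤ ‖P.opA x‖ + ‖B x u‖ + ‖B u x‖ := by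
    refine (norm_sub_le _ _).trans (add_le_add ((norm_sub_le _ _).trans ?_) le_rfl)
    rw [norm_neg]
  have h5 : ‖x‖ ≤ 1 + ‖x‖ ^ 2 := by nlinarith [sq_nonneg (‖x‖ - 1), sq_nonneg ‖x‖]
  have h6 : ‖B‖ * ‖x‖ * ‖u‖ ≤ ‖B‖ * (‖x‖ ^ 2 + ‖u‖ ^ 2) := by
    rw [mul_assoc]
    refine mul_le_mul_of_nonneg_left ?_ B.opNorm_nonneg
    nlinarith [sq_nonneg (‖x‖ - ‖u‖), sq_nonneg ‖x‖, sq_nonneg ‖u‖]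
  have h7 : ‖B‖ * ‖u‖ * ‖x‖ = ‖B‖ * ‖x‖ * ‖u‖ := by ring
  linarith

/-- Coercivity of the drift: the term `⟨B(u, x), x⟩` vanishes, and interpolation and Young's
inequality absorb `⟨B(x, u), x⟩` into `‖x‖²`. -/
theorem AssumptionB.exists_drift_le (hB : AssumptionB P Q VtoQ QtoH B) :
    ∃ C : ℝ, ∀ u x : P.V,
      2 * drift P B u x x ≤ -‖x‖ ^ 2 + C ^ 2 * ‖u‖ ^ 2 * ‖P.incl x‖ ^ 2 := by
  obtain ⟨C, hC, h1, -⟩ := hB.exists_estimates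
  refine ⟨C, fun u x => ?_⟩
  have e1 : drift P B u x x = -‖x‖ ^ 2 - B x u x := by
    have : P.opA x x = ‖x‖ ^ 2 := real_inner_self_eq_norm_sq x
    simp only [drift, sub_apply, neg_apply, this,
      hB.apply_self_eq_zero u x, sub_zero]
  rw [e1]
  have h2 := neg_le_of_abs_le (h1 x u)
  nlinarith [sq_nonneg (‖x‖ - C * ‖P.incl x‖ * ‖u‖)]

theorem PosDefOperator.MemCL2.exists_bound {Y : ℝ → H} (hY : P.MemCL2 T Y) :
    ∃ M, ∀ᵐ t ∂volume.restrict (Icc 0 T), ‖P.incl (P.toV (Y t))‖ ≤ M := by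
  obtain ⟨M, hM⟩ := isCompact_Icc.exists_bound_of_continuousOn hY.continuousOn
  refine ⟨M, ?_⟩
  filter_upwards [hY.incl_toV_ae, ae_restrict_mem measurableSet_Icc] with t h1 h2
  rw [h1]
  exact hM t h2

theorem PosDefOperator.MemCL2.memLp_opA {Y : ℝ → H} (hY : P.MemCL2 T Y) :
    MemLp (fun t => P.opA (P.toV (Y t))) 2 (volume.restrict (Icc 0 T)) :=
  hY.memLp.of_le (P.opA.continuous.comp_aestronglyMeasurable hY.memLp.1)
    (Eventually.of_forall fun _ => (innerSL_apply_norm ℝ _).le)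

theorem memLp_drift (hB : AssumptionB P Q VtoQ QtoH B) {Y : ℝ → H}
    (hu : P.MemCL2 T u₀) (hY : P.MemCL2 T Y) :
    MemLp (fun t => drift P B (P.toV (u₀ t)) (P.toV (Y t))) 2 (volume.restrict (Icc 0 T)) := by
  obtain ⟨M, hM⟩ := hu.exists_bound
  obtain ⟨N, hN⟩ := hY.exists_bound
  exact (hY.memLp_opA.neg.sub (hB.memLp_two hY.memLp hu.memLp hN hM)).sub
    (hB.memLp_two hu.memLp hY.memLp hM hN)

theorem isFiniteMeasure_Icc (T : ℝ) : IsFiniteMeasure (volume.restrict (Icc 0 T)) :=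
  ⟨by rw [Measure.restrict_apply_univ]; exact isCompact_Icc.measure_lt_top⟩

theorem integrableOn_apply {w : ℝ → P.V →L[ℝ] ℝ} (hw : MemLp w 2 (volume.restrict (Icc 0 T)))
    (v : P.V) : IntegrableOn (fun t => w t v) (Icc 0 T) := by
  have := isFiniteMeasure_Icc T
  exact (ContinuousLinearMap.apply ℝ ℝ v).integrable_comp (hw.integrable (by norm_num))

theorem intervalIntegrable_of_integrableOn_Icc {f : ℝ → ℝ} (hf : IntegrableOn f (Icc 0 T)) {t : ℝ}
    (ht : t ∈ Icc 0 T) : IntervalIntegrable f volume 0 t := by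
  refine IntegrableOn.intervalIntegrable ?_
  rw [uIcc_of_le ht.1]
  exact hf.mono_set (Icc_subset_Icc le_rfl ht.2)

variable {Z : Type*} [MeasurableSpace Z] {ν : Measure Z} {G : ℝ → H → Z → H}

theorem IsSkeletonSolution.apply_zero {φ : Lp ℝ 2 (nuT T ν)} {Y : ℝ → H} (hT : 0 ≤ T)
    (hY : IsSkeletonSolution P B T ν G u₀ φ Y) : Y 0 = 0 := by
  refine P.dense_range_incl.eq_zero_of_inner_left (𝕜 := ℝ) ?_
  rintro _ ⟨v, rfl⟩
  simpa using hY.eqn 0 ⟨le_rfl, hT⟩ v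

variable [SFinite ν]

/-- The skeleton equation, with its terms collected under one integral. -/
theorem IsSkeletonSolution.eqn_drift (hB : AssumptionB P Q VtoQ QtoH B)
    (hu : P.MemCL2 T u₀) {φ : Lp ℝ 2 (nuT T ν)} {Y : ℝ → H}
    (hg : MemLp (fun p : ℝ × Z => G p.1 (u₀ p.1) p.2) 2 (nuT T ν))
    (hY : IsSkeletonSolution P B T ν G u₀ φ Y) {t : ℝ} (ht : t ∈ Icc 0 T) (v : P.V) :
    inner ℝ (Y t) (P.incl v) = ∫ s in (0 : ℝ)..t, (drift P B (P.toV (u₀ s)) (P.toV (Y s)) v +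
      inner ℝ (forcing ν (fun p => G p.1 (u₀ p.1) p.2) φ s) (P.incl v)) := by
  obtain ⟨M, hM⟩ := hu.exists_bound
  obtain ⟨N, hN⟩ := hY.mem.exists_bound
  have i1 := intervalIntegrable_of_integrableOn_Icc (integrableOn_apply hY.mem.memLp_opA v) ht
  have i2 := intervalIntegrable_of_integrableOn_Icc
    (integrableOn_apply (hB.memLp_two hY.mem.memLp hu.memLp hN hM) v) ht
  have i3 := intervalIntegrable_of_integrableOn_Icc
    (integrableOn_apply (hB.memLp_two hu.memLp hY.mem.memLp hM hN) v) ht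
  have i4 : IntervalIntegrable (fun s => inner ℝ
      (forcing ν (fun p => G p.1 (u₀ p.1) p.2) φ s) (P.incl v)) volume 0 t :=
    intervalIntegrable_of_integrableOn_Icc
      ((integrableOn_forcing ν (Lp.memLp φ) hg).inner_const (P.incl v)) ht
  have e1 := intervalIntegral.integral_add ((i1.neg.sub i2).sub i3) i4
  have e2 := intervalIntegral.integral_sub (i1.neg.sub i2) i3
  have e3 := intervalIntegral.integral_sub i1.neg i2
  have e4 := intervalIntegral.integral_neg (μ := volume) (a := 0) (b := t)
    (f := fun s => P.opA (P.toV (Y s)) v)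
  rw [hY.eqn t ht v, ← e4]
  exact (e1.trans (congrArg (· + _) (e2.trans (congrArg (· - _) e3)))).symm

/-- The difference of two skeleton solutions satisfies the skeleton equation for the difference of
the controls, in energy form. -/
theorem IsSkeletonSolution.sub_eqn (hB : AssumptionB P Q VtoQ QtoH B)
    (hu : P.MemCL2 T u₀) {φ₁ φ₂ : Lp ℝ 2 (nuT T ν)} {Y₁ Y₂ : ℝ → H}
    (hg : MemLp (fun p : ℝ × Z => G p.1 (u₀ p.1) p.2) 2 (nuT T ν))
    (hY₁ : IsSkeletonSolution P B T ν G u₀ φ₁ Y₁) (hY₂ : IsSkeletonSolution P B T ν G u₀ φ₂ Y₂)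
    {t : ℝ} (ht : t ∈ Icc 0 T) (v : P.V) :
    inner ℝ (Y₁ t - Y₂ t) (P.incl v) =
      ∫ s in (0 : ℝ)..t, (drift P B (P.toV (u₀ s)) (P.toV (Y₁ s) - P.toV (Y₂ s)) v +
        inner ℝ (forcing ν (fun p => G p.1 (u₀ p.1) p.2) (φ₁ - φ₂ : Lp ℝ 2 (nuT T ν)) s)
          (P.incl v)) := by
  have ii : ∀ {φ : Lp ℝ 2 (nuT T ν)} {Y : ℝ → H}, IsSkeletonSolution P B T ν G u₀ φ Y →
      IntervalIntegrable (fun s => drift P B (P.toV (u₀ s)) (P.toV (Y s)) v +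
        inner ℝ (forcing ν (fun p => G p.1 (u₀ p.1) p.2) φ s) (P.incl v)) volume 0 t :=
    fun {φ Y} hY => (intervalIntegrable_of_integrableOn_Icc
      (integrableOn_apply (memLp_drift hB hu hY.mem) v) ht).add
      (intervalIntegrable_of_integrableOn_Icc
        ((integrableOn_forcing ν (Lp.memLp φ) hg).inner_const (P.incl v)) ht)
  rw [inner_sub_left, hY₁.eqn_drift hB hu hg ht, hY₂.eqn_drift hB hu hg ht,
    ← intervalIntegral.integral_sub (ii hY₁) (ii hY₂)]
  refine intervalIntegral.integral_congr_ae ?_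
  have h := forcing_sub_ae ν hg φ₁ φ₂
  rw [ae_restrict_iff' measurableSet_Icc] at h
  filter_upwards [h] with s hs hst
  rw [uIoc_of_le ht.1] at hst
  rw [hs ⟨hst.1.le, hst.2.trans ht.2⟩, drift_sub, inner_sub_left]
  simp only [sub_apply]
  ring

/-- **Stability.** The difference of two skeleton solutions is controlled, in `C([0,T]; H)` and in
`L²(0,T; V)`, by the work `∫₀ᵗ ⟪f, Y₁ - Y₂⟫` of the difference of the forcings; the constant depends
on `u⁰` only. -/
theorem exists_stability_const (hT : 0 < T) (hB : AssumptionB P Q VtoQ QtoH B)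
    (hu : P.MemCL2 T u₀)
    (hg : MemLp (fun p : ℝ × Z => G p.1 (u₀ p.1) p.2) 2 (nuT T ν)) :
    ∃ C : ℝ, 0 ≤ C ∧ ∀ {φ₁ φ₂ : Lp ℝ 2 (nuT T ν)} {Y₁ Y₂ : ℝ → H},
      IsSkeletonSolution P B T ν G u₀ φ₁ Y₁ → IsSkeletonSolution P B T ν G u₀ φ₂ Y₂ →
      ∀ β : ℝ, (∀ t ∈ Icc 0 T, |∫ p, (φ₁ - φ₂ : Lp ℝ 2 (nuT T ν)) p *
          inner ℝ (G p.1 (u₀ p.1) p.2) (Y₁ p.1 - Y₂ p.1) ∂nuT t ν| ≤ β) →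
        (∀ t ∈ Icc 0 T, ‖Y₁ t - Y₂ t‖ ^ 2 ≤ C * β) ∧
        ∫ t in Icc 0 T, ‖P.toV (Y₁ t) - P.toV (Y₂ t)‖ ^ 2 ≤ C * β := by
  obtain ⟨C₀, hC₀⟩ := hB.exists_drift_le
  set k : ℝ → ℝ := fun s => C₀ ^ 2 * ‖P.toV (u₀ s)‖ ^ 2 with hk
  have hk0 : ∀ t, 0 ≤ k t := fun t => by positivity
  have hki : IntegrableOn k (Icc 0 T) := hu.memLp.integrable_norm_pow (by norm_num) |>.const_mul _
  obtain ⟨C, hC, hgron⟩ := exists_gronwall_const hT.le hki hk0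
  have hTmem : T ∈ Icc 0 T := ⟨hT.le, le_rfl⟩
  set K := ∫ s in (0 : ℝ)..T, k s with hKdef
  have hK0 : 0 ≤ K := intervalIntegral.integral_nonneg hT.le fun t _ => hk0 t
  refine ⟨C * 2 + K * (C * 2) + 2, by positivity, ?_⟩
  intro φ₁ φ₂ Y₁ Y₂ hY₁ hY₂ β hβ
  have hβ0 : 0 ≤ β := (abs_nonneg _).trans (hβ T hTmem)
  set g : ℝ × Z → H := fun p => G p.1 (u₀ p.1) p.2 with hgdef
  set X : ℝ → H := fun t => Y₁ t - Y₂ t with hXdef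
  set x : ℝ → P.V := fun t => P.toV (Y₁ t) - P.toV (Y₂ t) with hxdef
  set f : ℝ → H := forcing ν g (φ₁ - φ₂ : Lp ℝ 2 (nuT T ν)) with hfdef
  have hX : ContinuousOn X (Icc 0 T) := hY₁.mem.continuousOn.sub hY₂.mem.continuousOn
  have hx : MemLp x 2 (volume.restrict (Icc 0 T)) := hY₁.mem.memLp.sub hY₂.mem.memLp
  have hw : MemLp (fun t => drift P B (P.toV (u₀ t)) (x t)) 2 (volume.restrict (Icc 0 T)) := by
    simp only [hxdef, drift_sub]
    exact (memLp_drift hB hu hY₁.mem).sub (memLp_drift hB hu hY₂.mem)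
  have hf : IntegrableOn f (Icc 0 T) := integrableOn_forcing ν (Lp.memLp _) hg
  have hX0 : X 0 = 0 := by
    simp only [hXdef, hY₁.apply_zero hT.le, hY₂.apply_zero hT.le, sub_zero]
  have hxX : ∀ᵐ t ∂volume.restrict (Icc 0 T), P.inclL (x t) = X t := by
    filter_upwards [hY₁.mem.incl_toV_ae, hY₂.mem.incl_toV_ae] with t h1 h2
    rw [P.inclL_apply, map_sub, h1, h2]
  have energy : ∀ t ∈ Icc 0 T, ‖X t‖ ^ 2 = ∫ r in (0 : ℝ)..t,
      2 * (drift P B (P.toV (u₀ r)) (x r) (x r) + inner ℝ (f r) (X r)) := by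
    intro t ht
    have := energy_equality P.inclL hT hX hx hw hf hxX (fun t ht v => by
      rw [hX0, inner_zero_left, zero_add]
      exact hY₁.sub_eqn hB hu hg hY₂ ht v) ht
    rwa [hX0, norm_zero, zero_pow two_ne_zero, zero_add] at this
  have iwx : IntegrableOn (fun r => drift P B (P.toV (u₀ r)) (x r) (x r)) (Icc 0 T) :=
    integrable_apply_of_memLp_two hw hx
  have ifX : IntegrableOn (fun r => inner ℝ (f r) (X r)) (Icc 0 T) :=
    integrable_inner_of_continuousOn hf hX
  have ix2 : IntegrableOn (fun r => ‖x r‖ ^ 2) (Icc 0 T) := hx.integrable_norm_pow (by norm_num)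
  have ikX : IntegrableOn (fun r => k r * ‖X r‖ ^ 2) (Icc 0 T) :=
    hki.mul_continuousOn (hX.norm.pow 2) isCompact_Icc
  have ineq : ∀ t ∈ Icc 0 T, ‖X t‖ ^ 2 + ∫ r in (0 : ℝ)..t, ‖x r‖ ^ 2 ≤
      2 * β + ∫ r in (0 : ℝ)..t, k r * ‖X r‖ ^ 2 := by
    intro t ht
    have jwx := intervalIntegrable_of_integrableOn_Icc iwx ht
    have jfX := intervalIntegrable_of_integrableOn_Icc ifX ht
    have jx2 := intervalIntegrable_of_integrableOn_Icc ix2 ht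
    have jkX := intervalIntegrable_of_integrableOn_Icc ikX ht
    have e : ‖X t‖ ^ 2 = (∫ r in (0 : ℝ)..t, 2 * drift P B (P.toV (u₀ r)) (x r) (x r)) +
        2 * ∫ r in (0 : ℝ)..t, inner ℝ (f r) (X r) := by
      rw [energy t ht, intervalIntegral.integral_const_mul, intervalIntegral.integral_add jwx jfX,
        mul_add, intervalIntegral.integral_const_mul]
    have b1 : ∫ r in (0 : ℝ)..t, 2 * drift P B (P.toV (u₀ r)) (x r) (x r) ≤
        ∫ r in (0 : ℝ)..t, (-‖x r‖ ^ 2 + k r * ‖X r‖ ^ 2) := by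
      refine intervalIntegral.integral_mono_ae_restrict ht.1 (jwx.const_mul 2)
        (jx2.neg.add jkX) ?_
      have h := ae_restrict_of_ae_restrict_of_subset (Icc_subset_Icc le_rfl ht.2) hxX
      filter_upwards [h] with r hr
      have := hC₀ (P.toV (u₀ r)) (x r)
      rw [P.inclL_apply] at hr
      rw [hr] at this
      exact this
    have b3 : ∫ r in (0 : ℝ)..t, (-‖x r‖ ^ 2 + k r * ‖X r‖ ^ 2) =
        -(∫ r in (0 : ℝ)..t, ‖x r‖ ^ 2) + ∫ r in (0 : ℝ)..t, k r * ‖X r‖ ^ 2 := by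
      rw [← intervalIntegral.integral_neg]
      exact intervalIntegral.integral_add jx2.neg jkX
    have b2 : ∫ r in (0 : ℝ)..t, inner ℝ (f r) (X r) ≤ β := by
      rw [integral_inner_forcing ν (Lp.memLp _) hg hX ht]
      exact (le_abs_self _).trans (hβ t ht)
    linarith
  have hXβ : ∀ t ∈ Icc 0 T, ‖X t‖ ^ 2 ≤ C * (2 * β) := by
    refine hgron (fun t => ‖X t‖ ^ 2) (2 * β) (hX.norm.pow 2) (by positivity) fun t ht => ?_
    have h1 := ineq t ht
    have h2 : 0 ≤ ∫ r in (0 : ℝ)..t, ‖x r‖ ^ 2 :=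
      intervalIntegral.integral_nonneg ht.1 fun _ _ => by positivity
    linarith
  have hCβ : 0 ≤ C * β := by positivity
  have hKCβ : 0 ≤ K * (C * β) := by positivity
  refine ⟨fun t ht => (hXβ t ht).trans (by nlinarith), ?_⟩
  have h1 := ineq T hTmem
  have h2 : ∫ r in (0 : ℝ)..T, k r * ‖X r‖ ^ 2 ≤ K * (C * (2 * β)) := by
    rw [hKdef, ← intervalIntegral.integral_mul_const]
    exact intervalIntegral.integral_mono_on hT.le
      (intervalIntegrable_of_integrableOn_Icc ikX hTmem)
      ((intervalIntegrable_of_integrableOn_Icc hki hTmem).mul_const _)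
      fun s hs => mul_le_mul_of_nonneg_left (hXβ s hs) (hk0 s)
  rw [intervalIntegral.integral_of_le hT.le, ← integral_Icc_eq_integral_Ioc] at h1
  have h3 : 0 ≤ ‖X T‖ ^ 2 := by positivity
  nlinarith

end Skeleton

/-! ### Convergence of the solutions -/

section Convergence

set_option maxSynthPendingDepth 3

/-- The identity is an admissible time change, so uniform convergence implies `J₁`-convergence. -/
theorem skorokhodEDist_le_iSup {E : Type*} [PseudoEMetricSpace E] (T : ℝ) (x y : ℝ → E) :
    skorokhodEDist T x y ≤ ⨆ t : Icc (0 : ℝ) T, edist (x t) (y t) := by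
  refine (iInf_le _ (OrderIso.refl _)).trans ?_
  simp

theorem tendsto_inner_sub_of_tendsto_weak {E : Type*} [NormedAddCommGroup E]
    [InnerProductSpace ℝ E] {φn : ℕ → E} {φ : E}
    (h : Tendsto (fun n => toWeakSpace ℝ E (φn n)) atTop (𝓝 (toWeakSpace ℝ E φ))) (e : E) :
    Tendsto (fun n => inner ℝ e (φn n - φ)) atTop (𝓝 0) := by
  have h1 := ((WeakBilin.eval_continuous (topDualPairing ℝ E).flip (innerSL ℝ e)).tendsto _).comp h
  have h2 : Tendsto (fun n => inner ℝ e (φn n)) atTop (𝓝 (inner ℝ e φ)) := h1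
  have h3 := h2.sub_const (inner ℝ e φ)
  rw [sub_self] at h3
  exact h3.congr fun n => (inner_sub_right _ _ _).symm

variable {H : Type*} [NormedAddCommGroup H] [InnerProductSpace ℝ H] [CompleteSpace H]
  {P : PosDefOperator H} {Q : Type*} [NormedAddCommGroup Q] [NormedSpace ℝ Q]
  {VtoQ : P.V →ₗ[ℝ] Q} {QtoH : Q →ₗ[ℝ] H} {B : P.V →L[ℝ] P.V →L[ℝ] (P.V →L[ℝ] ℝ)}
  {T : ℝ} {u₀ : ℝ → H}
  {Z : Type*} [MeasurableSpace Z] {ν : Measure Z} [SFinite ν] {G : ℝ → H → Z → H}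

/-- A priori bounds for differences of skeleton solutions, uniform over controls at distance at
most `R`: the work of the forcing is at most a multiple of `sup ‖Y₁ - Y₂‖`, which the stability
estimate bounds from below by a multiple of `sup ‖Y₁ - Y₂‖²`. -/
theorem exists_apriori_bound (hT : 0 < T) (hB : AssumptionB P Q VtoQ QtoH B)
    (hu : P.MemCL2 T u₀)
    (hg : MemLp (fun p : ℝ × Z => G p.1 (u₀ p.1) p.2) 2 (nuT T ν)) (R : ℝ) :
    ∃ M E : ℝ, ∀ {φ₁ φ₂ : Lp ℝ 2 (nuT T ν)} {Y₁ Y₂ : ℝ → H}, ‖φ₁ - φ₂‖ ≤ R →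
      IsSkeletonSolution P B T ν G u₀ φ₁ Y₁ → IsSkeletonSolution P B T ν G u₀ φ₂ Y₂ →
      (∀ t ∈ Icc 0 T, ‖Y₁ t - Y₂ t‖ ≤ M) ∧
        ∫ t in Icc 0 T, ‖P.toV (Y₁ t) - P.toV (Y₂ t)‖ ^ 2 ≤ E := by
  obtain ⟨C, hC, hstab⟩ := exists_stability_const hT hB hu hg
  set N := (eLpNorm (fun p : ℝ × Z => G p.1 (u₀ p.1) p.2) 2 (nuT T ν)).toReal with hN
  have hN0 : 0 ≤ N := ENNReal.toReal_nonneg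
  refine ⟨C * (R * N), C * ((C * (R * N)) * (R * N)), ?_⟩
  intro φ₁ φ₂ Y₁ Y₂ hR hY₁ hY₂
  have hR0 : 0 ≤ R := (norm_nonneg _).trans hR
  have hX : ContinuousOn (fun t => Y₁ t - Y₂ t) (Icc 0 T) :=
    hY₁.mem.continuousOn.sub hY₂.mem.continuousOn
  obtain ⟨τ, hτ, hmax⟩ := isCompact_Icc.exists_isMaxOn ⟨0, le_rfl, hT.le⟩ hX.norm
  set S := ‖Y₁ τ - Y₂ τ‖ with hS
  have hle : ∀ t ∈ Icc 0 T, ‖Y₁ t - Y₂ t‖ ≤ S := fun t ht => hmax ht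
  have hwork : ∀ t ∈ Icc 0 T, |∫ p, (φ₁ - φ₂ : Lp ℝ 2 (nuT T ν)) p *
      inner ℝ (G p.1 (u₀ p.1) p.2) (Y₁ p.1 - Y₂ p.1) ∂nuT t ν| ≤ S * (R * N) := by
    intro t ht
    refine (abs_integral_mul_inner_le ht.2 ν (Lp.memLp (φ₁ - φ₂)) hg hX hle).trans ?_
    refine mul_le_mul_of_nonneg_left ?_ (norm_nonneg _)
    exact mul_le_mul_of_nonneg_right hR hN0
  obtain ⟨h1, h2⟩ := hstab hY₁ hY₂ _ hwork
  have hSM : S ≤ C * (R * N) := by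
    have h3 : S ^ 2 ≤ C * (S * (R * N)) := h1 τ hτ
    rcases (norm_nonneg (Y₁ τ - Y₂ τ)).eq_or_lt with h0 | h0
    · rw [hS, ← h0]; positivity
    · refine le_of_mul_le_mul_right ?_ h0
      calc S * S = S ^ 2 := by ring
        _ ≤ C * (S * (R * N)) := h3
        _ = _ := by ring
  refine ⟨fun t ht => (hle t ht).trans hSM, h2.trans ?_⟩
  gcongr

/-- The work done by the difference of the forcings tends to zero uniformly in time. -/
theorem eventually_forall_work_le (hT : 0 < T) (hB : AssumptionB P Q VtoQ QtoH B)
    (hu : P.MemCL2 T u₀)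
    (hg : MemLp (fun p : ℝ × Z => G p.1 (u₀ p.1) p.2) 2 (nuT T ν))
    {φn : ℕ → Lp ℝ 2 (nuT T ν)} {φ : Lp ℝ 2 (nuT T ν)} {R : ℝ} (hR : ∀ n, ‖φn n - φ‖ ≤ R)
    (hweak : ∀ e : Lp ℝ 2 (nuT T ν), Tendsto (fun n => inner ℝ e (φn n - φ)) atTop (𝓝 0))
    {Yn : ℕ → ℝ → H} {Y : ℝ → H}
    (hYn : ∀ n, IsSkeletonSolution P B T ν G u₀ (φn n) (Yn n))
    (hY : IsSkeletonSolution P B T ν G u₀ φ Y) {ε : ℝ} (hε : 0 < ε) :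
    ∀ᶠ n in atTop, ∀ t ∈ Icc 0 T, |∫ p, (φn n - φ : Lp ℝ 2 (nuT T ν)) p *
      inner ℝ (G p.1 (u₀ p.1) p.2) (Yn n p.1 - Y p.1) ∂nuT t ν| ≤ ε := by
  obtain ⟨M, E, hME⟩ := exists_apriori_bound hT hB hu hg R
  have hfin := isFiniteMeasure_Icc T
  refine eventually_forall_abs_integral_mul_inner_le ν hR hweak
    (X := fun n t => Yn n t - Y t)
    (fun n => (hYn n).mem.continuousOn.sub hY.mem.continuousOn)
    (fun n => (hME (hR n) (hYn n) hY).1) P.dense_range_incl ?_ hg hε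
  rintro _ ⟨v, rfl⟩
  set g : ℝ × Z → H := fun p => G p.1 (u₀ p.1) p.2 with hgdef
  -- the bound comes from `norm_drift_le`, integrated over `[0,T]`
  set U := ∫ t in Icc 0 T, ‖P.toV (u₀ t)‖ ^ 2 with hU
  refine ⟨(T + E + 2 * ‖B‖ * (E + U)) * ‖v‖ + R * (eLpNorm g 2 (nuT T ν)).toReal * ‖P.incl v‖,
    fun n => ?_⟩
  set x : ℝ → P.V := fun t => P.toV (Yn n t) - P.toV (Y t) with hx
  set f : ℝ → H := forcing ν g (φn n - φ : Lp ℝ 2 (nuT T ν)) with hf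
  have hxm : MemLp x 2 (volume.restrict (Icc 0 T)) := (hYn n).mem.memLp.sub hY.mem.memLp
  have hw : MemLp (fun t => drift P B (P.toV (u₀ t)) (x t)) 2 (volume.restrict (Icc 0 T)) := by
    simp only [hx, drift_sub]
    exact (memLp_drift hB hu (hYn n).mem).sub (memLp_drift hB hu hY.mem)
  have hwi : IntegrableOn (fun t => drift P B (P.toV (u₀ t)) (x t)) (Icc 0 T) :=
    hw.integrable (by norm_num)
  have hfi : IntegrableOn f (Icc 0 T) := integrableOn_forcing ν (Lp.memLp _) hg
  have ix2 : IntegrableOn (fun t => ‖x t‖ ^ 2) (Icc 0 T) := hxm.integrable_norm_pow (by norm_num)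
  have iu2 : IntegrableOn (fun t => ‖P.toV (u₀ t)‖ ^ 2) (Icc 0 T) :=
    hu.memLp.integrable_norm_pow (by norm_num)
  have hd : IntegrableOn (fun s => drift P B (P.toV (u₀ s)) (x s) v +
      inner ℝ (f s) (P.incl v)) (Icc 0 T) :=
    (integrableOn_apply hw v).add (hfi.inner_const _)
  refine ⟨_, hd, ?_, fun t ht => ?_⟩
  · have b1 : ∫ s in Icc 0 T, ‖drift P B (P.toV (u₀ s)) (x s)‖ ≤ T + E + 2 * ‖B‖ * (E + U) := by
      have hE : ∫ s in Icc 0 T, ‖x s‖ ^ 2 ≤ E := (hME (hR n) (hYn n) hY).2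
      have i1 : IntegrableOn (fun s => 1 + ‖x s‖ ^ 2) (Icc 0 T) :=
        (integrable_const (1 : ℝ)).add ix2
      have i2 : IntegrableOn (fun s => 2 * ‖B‖ * (‖x s‖ ^ 2 + ‖P.toV (u₀ s)‖ ^ 2)) (Icc 0 T) :=
        (ix2.add iu2).const_mul (2 * ‖B‖)
      calc ∫ s in Icc 0 T, ‖drift P B (P.toV (u₀ s)) (x s)‖
          ≤ ∫ s in Icc 0 T, (1 + ‖x s‖ ^ 2 + 2 * ‖B‖ * (‖x s‖ ^ 2 + ‖P.toV (u₀ s)‖ ^ 2)) :=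
            integral_mono hwi.norm (Integrable.add i1 i2) fun s => norm_drift_le _ _
        _ = T + (∫ s in Icc 0 T, ‖x s‖ ^ 2) + 2 * ‖B‖ * ((∫ s in Icc 0 T, ‖x s‖ ^ 2) + U) := by
            rw [integral_add i1 i2, integral_add (integrable_const _) ix2, integral_const_mul,
              integral_add ix2 iu2]
            simp [hT.le, hU]
        _ ≤ _ := by
            have := B.opNorm_nonneg
            gcongr
    have b2 := integral_norm_forcing_le ν hT.le (Lp.memLp (φn n - φ)) hg
    rw [intervalIntegral.integral_of_le hT.le, ← integral_Icc_eq_integral_Ioc] at b2 ⊢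
    have b3 : ∫ s in Icc 0 T, ‖f s‖ ≤ R * (eLpNorm g 2 (nuT T ν)).toReal :=
      b2.trans (mul_le_mul_of_nonneg_right (hR n) ENNReal.toReal_nonneg)
    calc ∫ s in Icc 0 T, |drift P B (P.toV (u₀ s)) (x s) v + inner ℝ (f s) (P.incl v)|
        ≤ ∫ s in Icc 0 T, (‖drift P B (P.toV (u₀ s)) (x s)‖ * ‖v‖ + ‖f s‖ * ‖P.incl v‖) := by
          refine integral_mono hd.norm ((hwi.norm.mul_const _).add (hfi.norm.mul_const _))
            fun s => ?_
          exact (abs_add_le _ _).trans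
            (add_le_add ((drift P B (P.toV (u₀ s)) (x s)).le_opNorm v) (abs_real_inner_le_norm _ _))
      _ = (∫ s in Icc 0 T, ‖drift P B (P.toV (u₀ s)) (x s)‖) * ‖v‖ +
            (∫ s in Icc 0 T, ‖f s‖) * ‖P.incl v‖ := by
          rw [integral_add (hwi.norm.mul_const _) (hfi.norm.mul_const _), integral_mul_const,
            integral_mul_const]
      _ ≤ _ := by gcongr
  · rw [real_inner_comm]
    exact (hYn n).sub_eqn hB hu hg hY ht v

end Convergence

end Hydro

end

theorem proposition3p1
    {H : Type*} [NormedAddCommGroup H] [InnerProductSpace ℝ H] [CompleteSpace H]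
    [TopologicalSpace.SeparableSpace H] [MeasurableSpace H] [BorelSpace H]
    {Z : Type*} [TopologicalSpace Z] [PolishSpace Z] [LocallyCompactSpace Z]
    [MeasurableSpace Z] [BorelSpace Z]
    (ν : Measure Z) [IsFiniteMeasureOnCompacts ν]
    (T : ℝ) (hT : 0 < T)
    (P : Hydro.PosDefOperator H)
    {Q : Type*} [NormedAddCommGroup Q] [NormedSpace ℝ Q]
    (VtoQ : P.V →ₗ[ℝ] Q) (QtoH : Q →ₗ[ℝ] H)
    (B : P.V →L[ℝ] P.V →L[ℝ] (P.V →L[ℝ] ℝ))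
    (hB : Hydro.AssumptionB P Q VtoQ QtoH B)
    (G : ℝ → H → Z → H) (hG : Hydro.AssumptionG P T ν G)
    (x₀ : H) (u₀ : ℝ → H) (hu₀ : Hydro.IsLimitSolution P B T x₀ u₀)
    (m : ℝ) (hm : 0 < m)
    (φn : ℕ → Lp ℝ 2 (Hydro.nuT T ν)) (φ : Lp ℝ 2 (Hydro.nuT T ν))
    (hφn : ∀ n, φn n ∈ Metric.closedBall (0 : Lp ℝ 2 (Hydro.nuT T ν)) m)
    (hφ : φ ∈ Metric.closedBall (0 : Lp ℝ 2 (Hydro.nuT T ν)) m)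
    (hweak : Tendsto (fun n => toWeakSpace ℝ (Lp ℝ 2 (Hydro.nuT T ν)) (φn n)) atTop
      (𝓝 (toWeakSpace ℝ (Lp ℝ 2 (Hydro.nuT T ν)) φ)))
    (Yn : ℕ → ℝ → H) (Y : ℝ → H)
    (hYn : ∀ n, Hydro.IsSkeletonSolution P B T ν G u₀ (φn n) (Yn n))
    (hY : Hydro.IsSkeletonSolution P B T ν G u₀ φ Y) :
    Hydro.TendstoDL2 P T Yn Y := by
  have : IsLocallyFiniteMeasure ν := isLocallyFiniteMeasure_of_isFiniteMeasureOnCompacts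
  have hg := hG.memLp_two hT hu₀.mem
  have hR : ∀ n, ‖φn n - φ‖ ≤ m + m := fun n =>
    (norm_sub_le _ _).trans (add_le_add (mem_closedBall_zero_iff.1 (hφn n))
      (mem_closedBall_zero_iff.1 hφ))
  obtain ⟨C, hC, hstab⟩ := Hydro.exists_stability_const hT hB hu₀.mem hg
  have key : ∀ ε : ℝ, 0 < ε → ∀ᶠ n in atTop, (∀ t ∈ Icc 0 T, ‖Yn n t - Y t‖ ^ 2 ≤ ε ^ 2) ∧
      ∫ t in Icc 0 T, ‖P.toV (Yn n t) - P.toV (Y t)‖ ^ 2 ≤ ε ^ 2 := by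
    intro ε hε
    filter_upwards [Hydro.eventually_forall_work_le hT hB hu₀.mem hg hR
      (Hydro.tendsto_inner_sub_of_tendsto_weak hweak) hYn hY
      (ε := ε ^ 2 / (C + 1)) (by positivity)] with n hn
    obtain ⟨h1, h2⟩ := hstab (hYn n) hY _ hn
    have h3 : C * (ε ^ 2 / (C + 1)) ≤ ε ^ 2 := by
      rw [mul_div_assoc', div_le_iff₀ (by positivity)]
      nlinarith [sq_nonneg ε]
    exact ⟨fun t ht => (h1 t ht).trans h3, h2.trans h3⟩
  have ofReal_le : ∀ {δ : ℝ≥0∞}, 0 < δ → ∃ ε : ℝ, 0 < ε ∧ ENNReal.ofReal ε ≤ δ := by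
    intro δ hδ
    obtain ⟨r, hr0, hr⟩ := ENNReal.lt_iff_exists_nnreal_btwn.1 hδ
    exact ⟨r, by exact_mod_cast hr0, by rw [ENNReal.ofReal_coe_nnreal]; exact hr.le⟩
  constructor
  · rw [ENNReal.tendsto_nhds_zero]
    intro δ hδ
    obtain ⟨ε, hε, hεδ⟩ := ofReal_le hδ
    filter_upwards [key ε hε] with n hn
    refine ((Hydro.skorokhodEDist_le_iSup T _ _).trans (iSup_le fun t => ?_)).trans hεδ
    rw [edist_dist, dist_eq_norm]
    exact ENNReal.ofReal_le_ofReal (le_of_sq_le_sq (hn.1 t t.2) hε.le)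
  · rw [ENNReal.tendsto_nhds_zero]
    intro δ hδ
    obtain ⟨ε, hε, hεδ⟩ := ofReal_le hδ
    filter_upwards [key ε hε] with n hn
    refine le_trans ?_ hεδ
    have hx : MemLp (fun t => P.toV (Yn n t) - P.toV (Y t)) 2 (volume.restrict (Icc 0 T)) :=
      (hYn n).mem.memLp.sub hY.mem.memLp
    rw [hx.eLpNorm_eq_integral_rpow_norm (by norm_num) (by norm_num)]
    refine ENNReal.ofReal_le_ofReal ?_
    simp only [ENNReal.toReal_ofNat, Real.rpow_ofNat]
    rw [← one_div, ← Real.sqrt_eq_rpow]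
    exact Real.sqrt_le_iff.2 ⟨hε.le, hn.2⟩
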